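/- Let $G$ be a connected semisimple Lie group with finite center and Lie algebra $\mathfrak g$, with Killing form $B$, Cartan involution $\theta$ and Cartan decomposition $\mathfrak g=\mathfrak k\oplus\mathfrak q$. Let $\mathfrak a_0\subset\mathfrak q$ be maximal abelian, $\Delta_r^+$ a positive system of restricted roots, $\mathfrak m_0$ the centralizer of $\mathfrak a_0$ in $\mathfrak k$, $\mathfrak n_0$ the sum of the positive restricted root spaces, and let $\mathfrak p\neq\mathfrak g$ be a (parabolic) subalgebra containing $\mathfrak p_0=\mathfrak m_0\oplus\mathfrak a_0\oplus\mathfrak n_0$. Let $K$ be the maximal compact subgroup of $G$ with Lie algebra $\mathfrak k$, let $P$ be a parabolic subgroup with Lie algebra $\mathfrak p$ (a closed subgroup with this Lie algebra), put $M=K\cap P$ and let $\mathfrak m$ be the Lie algebra of $M$. Let $\mathfrak g=\bigoplus_i\mathfrak g_i$ be the grading induced by $\mathfrak p$: if $\Sigma$ is the set of simple restricted roots $\alpha$ with $\mathfrak g_{-\alpha}\not\subset\mathfrak p$, then $\mathfrak g_i$ is the sum of the spaces $\mathfrak g_\alpha=\{X:[H,X]=\alpha(H)X\ \forall H\in\mathfrak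 a_0\}$ over those integral combinations $\alpha$ of simple roots (including $\alpha=0$) whose coefficients at the elements of $\Sigma$ add up to $i$. Let $E$ be the grading element, i.e. the element of the center of $\mathfrak g_0$ with $[E,X]=iX$ for all $i$ and all $X\in\mathfrak g_i$. Let $(\mathfrak g/\mathfrak m)_i$ be the image of $\mathfrak g_i$ in $\mathfrak g/\mathfrak m$, and put $(\mathfrak g/\mathfrak m)^{1,0}=\mathfrak p/\mathfrak m$ and $(\mathfrak g/\mathfrak m)^{0,1}=\mathfrak k/\mathfrak m$. A form on $\mathfrak g/\mathfrak m$ of total degree $p+q$ has degree $(p,q)$ if it vanishes upon insertion of $p+1$ vectors of $(\mathfrak g/\mathfrak m)^{1,0}$ and upon insertion of $q+1$ vectors of $(\mathfrak g/\mathfrak m)^{0,1}$. $M$-invariant forms on $\mathfrak g/\mathfrak m$ are identified with $G$-invariant differential forms on $G/M$; the exterior derivative splits as $d=d_K+d_P$, where on forms of degree $(p,q)$ the $K$-derivative $d_K$ is the component of degree $(p+1,q)$ and the $P$-derivative $d_P$ the component of degree $(p,q+1)$. For $X\in\mathfrak g_i$ and $Y\in\mathfrak g_{-i}$ with $i>0$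 put $F_X=X+\mathfrak m$ and $G_Y=Y+\theta(Y)+\mathfrak m$. Then there is a unique $E^*\in(\mathfrak g/\mathfrak m)^*$ dual to $E$, in the sense that $E^*(E+\mathfrak m)=1$, that $E^*(X+\mathfrak m)=0$ for all $X\in\mathfrak g_0\cap\mathfrak q$ with $B(E,X)=0$, and that $E^*$ vanishes on $(\mathfrak g/\mathfrak m)_i$ for all $i\ne0$. It is nonzero, $M$-invariant and of degree $(1,0)$. Its $K$-derivative is zero; moreover $B(E,E)\neq0$, and its $P$-derivative satisfies \[ d_PE^*(F_X,G_Y)=-\,i\,B(E,E)^{-1}B(X,Y) \] for all $i>0$, $X\in\mathfrak g_i$ and $Y\in\mathfrak g_{-i}$ (equivalently $d_PE^*(G_Y,F_X)=i\,B(E,E)^{-1}B(X,Y)$). The form $d_PE^*$ and the subspaces $(\mathfrak g/\mathfrak m)_i$ are $M$-invariant, and for every $i>0$ the restriction of $d_PE^*$ to $(\mathfrak g/\mathfrak m)_{-i}\times(\mathfrak g/\mathfrak m)_i$ is nondegenerate. -/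

import Mathlib

open Module
open scoped Manifold ContDiff

noncomputable section

namespace PoissonTransform

/-! ### Real semisimple Lie algebras: Cartan involutions, restricted roots, parabolics -/

section LieAlgebraPart

variable {L : Type*} [LieRing L] [LieAlgebra ℝ L]

/-- A Cartan involution: an involutive automorphism `θ` such that
`(X, Y) ↦ -B(X, θ Y)` is positive definite, `B` being the Killing form. -/
structure IsCartanInvolution (θ : L ≃ₗ⁅ℝ⁆ L) : Prop where
  involutive : ∀ X : L, θ (θ X) = X
  posDef : ∀ X : L, X ≠ 0 → 0 < -(killingForm ℝ L X (θ X))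

/-- The `+1`-eigenspace `𝔨` of `θ`. -/
def kPart (θ : L ≃ₗ⁅ℝ⁆ L) : Submodule ℝ L where
  carrier := {X | θ X = X}
  add_mem' {X Y} hX hY := by
    simp only [Set.mem_ofPred_eq] at hX hY ⊢
    rw [map_add, hX, hY]
  zero_mem' := map_zero θ
  smul_mem' c X hX := by
    simp only [Set.mem_ofPred_eq] at hX ⊢
    rw [map_smul, hX]

/-- The `-1`-eigenspace `𝔮` of `θ`. -/
def qPart (θ : L ≃ₗ⁅ℝ⁆ L) : Submodule ℝ L where
  carrier := {X | θ X = -X}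
  add_mem' {X Y} hX hY := by
    simp only [Set.mem_ofPred_eq] at hX hY ⊢
    rw [map_add, hX, hY, neg_add]
  zero_mem' := by simp
  smul_mem' c X hX := by
    simp only [Set.mem_ofPred_eq] at hX ⊢
    rw [map_smul, hX, smul_neg]

/-- A subspace on which the bracket vanishes. -/
def IsAbelianSubspace (𝔞 : Submodule ℝ L) : Prop :=
  ∀ X ∈ 𝔞, ∀ Y ∈ 𝔞, ⁅X, Y⁆ = 0

/-- `𝔞` is a maximal abelian subspace of `𝔮`. -/
structure IsMaximalAbelian (θ : L ≃ₗ⁅ℝ⁆ L) (𝔞 : Submodule ℝ L) : Prop where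
  le_q : 𝔞 ≤ qPart θ
  abelian : IsAbelianSubspace 𝔞
  maximal : ∀ 𝔟 : Submodule ℝ L, 𝔟 ≤ qPart θ → IsAbelianSubspace 𝔟 → 𝔞 ≤ 𝔟 → 𝔟 = 𝔞

/-- The simultaneous eigenspace of `ad 𝔞` for the functional `α` (the restricted root space
if `α` is a restricted root, the centralizer of `𝔞` if `α = 0`). -/
def rootSpace (𝔞 : Submodule ℝ L) (α : Dual ℝ 𝔞) : Submodule ℝ L where
  carrier := {X | ∀ H : 𝔞, ⁅(H : L), X⁆ = α H • X}
  add_mem' {X Y} hX hY := by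
    intro H
    rw [lie_add, hX H, hY H, smul_add]
  zero_mem' := by
    intro H
    simp
  smul_mem' c X hX := by
    intro H
    rw [lie_smul, hX H, smul_comm]

/-- The set `Δ_r` of restricted roots. -/
def restrictedRoots (𝔞 : Submodule ℝ L) : Set (Dual ℝ 𝔞) :=
  {α | α ≠ 0 ∧ rootSpace 𝔞 α ≠ ⊥}

/-- A positive subsystem of the restricted roots: the roots that are positive on the open
Weyl chamber of some regular element `H₀`. -/
def IsPositiveSystem (𝔞 : Submodule ℝ L) (Φ : Set (Dual ℝ 𝔞)) : Prop :=
  ∃ H₀ : 𝔞, (∀ α ∈ restrictedRoots 𝔞, α H₀ ≠ 0) ∧ Φ = {α ∈ restrictedRoots 𝔞 | 0 < α H₀}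

/-- The centralizer `𝔪₀` of `𝔞` in `𝔨`. -/
def mZero (θ : L ≃ₗ⁅ℝ⁆ L) (𝔞 : Submodule ℝ L) : Submodule ℝ L :=
  kPart θ ⊓ rootSpace 𝔞 0

/-- The sum `𝔫₀` of the positive restricted root spaces. -/
def nZero (𝔞 : Submodule ℝ L) (Φ : Set (Dual ℝ 𝔞)) : Submodule ℝ L :=
  ⨆ α ∈ Φ, rootSpace 𝔞 α

/-- The minimal standard parabolic `𝔭₀ = 𝔪₀ ⊕ 𝔞 ⊕ 𝔫₀`. -/
def pZero (θ : L ≃ₗ⁅ℝ⁆ L) (𝔞 : Submodule ℝ L) (Φ : Set (Dual ℝ 𝔞)) : Submodule ℝ L :=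
  mZero θ 𝔞 ⊔ 𝔞 ⊔ nZero 𝔞 Φ

/-- The simple roots of a positive system: those positive roots that are not a sum of two
positive roots. -/
def simpleRoots {𝔞 : Submodule ℝ L} (Φ : Set (Dual ℝ 𝔞)) : Set (Dual ℝ 𝔞) :=
  {α ∈ Φ | ∀ β ∈ Φ, ∀ γ ∈ Φ, α ≠ β + γ}

/-- The set `Σ` of simple roots determined by a standard parabolic `𝔭`: those simple `α`
for which the root space of `-α` is not contained in `𝔭`. -/
def crossedRoots {𝔞 : Submodule ℝ L} (Φ : Set (Dual ℝ 𝔞)) (𝔭 : LieSubalgebra ℝ L) :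
    Set (Dual ℝ 𝔞) :=
  {α ∈ simpleRoots Φ | ¬ rootSpace 𝔞 (-α) ≤ 𝔭.toSubmodule}

open Classical in
/-- The `Σ`-height of an integral combination `∑ c_α α` of simple roots: the sum of the
coefficients of the roots in `Σ`. -/
def sigmaHeight {𝔞 : Submodule ℝ L} (Φ : Set (Dual ℝ 𝔞)) (𝔭 : LieSubalgebra ℝ L)
    (c : Dual ℝ 𝔞 →₀ ℤ) : ℤ :=
  c.sum fun α k => if α ∈ crossedRoots Φ 𝔭 then k else 0

/-- The component `𝔤_i` of the `|k|`-grading of `𝔤` induced by the standard parabolic `𝔭`: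
the sum of the simultaneous eigenspaces of `ad 𝔞` for the integral combinations of simple
roots of `Σ`-height `i` (for `i = 0` this contains the centralizer of `𝔞`, with `c = 0`). -/
def gradingPiece {𝔞 : Submodule ℝ L} (Φ : Set (Dual ℝ 𝔞)) (𝔭 : LieSubalgebra ℝ L) (i : ℤ) :
    Submodule ℝ L :=
  ⨆ (c : Dual ℝ 𝔞 →₀ ℤ) (_ : (c.support : Set (Dual ℝ 𝔞)) ⊆ simpleRoots Φ)
    (_ : sigmaHeight Φ 𝔭 c = i), rootSpace 𝔞 (c.sum fun α k => k • α)

/-- `E` is the grading element: it lies in the center of `𝔤_0` and `[E, X] = i X` for all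
`X ∈ 𝔤_i`. -/
structure IsGradingElement {𝔞 : Submodule ℝ L} (Φ : Set (Dual ℝ 𝔞)) (𝔭 : LieSubalgebra ℝ L)
    (E : L) : Prop where
  mem_zero : E ∈ gradingPiece Φ 𝔭 0
  central : ∀ X ∈ gradingPiece Φ 𝔭 0, ⁅E, X⁆ = 0
  lie_eq : ∀ i : ℤ, ∀ X ∈ gradingPiece Φ 𝔭 i, ⁅E, X⁆ = (i : ℝ) • X

/-- The subspace `(𝔤/𝔪)^{1,0} = 𝔭/𝔪` of `𝔤/𝔪`. -/
def quotOneZero (𝔪 : Submodule ℝ L) (𝔭 : LieSubalgebra ℝ L) : Submodule ℝ (L ⧸ 𝔪) :=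
  𝔭.toSubmodule.map 𝔪.mkQ

/-- The subspace `(𝔤/𝔪)^{0,1} = 𝔨/𝔪` of `𝔤/𝔪`. -/
def quotZeroOne (𝔪 : Submodule ℝ L) (θ : L ≃ₗ⁅ℝ⁆ L) : Submodule ℝ (L ⧸ 𝔪) :=
  (kPart θ).map 𝔪.mkQ

/-- The image `(𝔤/𝔪)_i` of `𝔤_i` in `𝔤/𝔪`. -/
def quotPiece {𝔞 : Submodule ℝ L} (𝔪 : Submodule ℝ L) (Φ : Set (Dual ℝ 𝔞))
    (𝔭 : LieSubalgebra ℝ L) (i : ℤ) : Submodule ℝ (L ⧸ 𝔪) :=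
  (gradingPiece Φ 𝔭 i).map 𝔪.mkQ

/-- `F_X = X + 𝔪`. -/
def vecF (𝔪 : Submodule ℝ L) (X : L) : L ⧸ 𝔪 := 𝔪.mkQ X

/-- `G_Y = Y + θ Y + 𝔪`. -/
def vecG (𝔪 : Submodule ℝ L) (θ : L ≃ₗ⁅ℝ⁆ L) (Y : L) : L ⧸ 𝔪 := 𝔪.mkQ (Y + θ Y)

/-- `ε` is the covector on `𝔤/𝔪` dual to `E`: it takes the value `1` on `E + 𝔪`, it vanishes on
the `B`-orthogonal complement of `E` in `𝔤_0 ∩ 𝔮 ≅ (𝔤/𝔪)_0`, and on all `(𝔤/𝔪)_i`, `i ≠ 0`. -/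
structure IsDualCovector {𝔞 : Submodule ℝ L} (θ : L ≃ₗ⁅ℝ⁆ L) (Φ : Set (Dual ℝ 𝔞))
    (𝔭 : LieSubalgebra ℝ L) (𝔪 : Submodule ℝ L) (E : L) (ε : Dual ℝ (L ⧸ 𝔪)) : Prop where
  apply_self : ε (𝔪.mkQ E) = 1
  apply_orthogonal : ∀ X ∈ gradingPiece Φ 𝔭 0 ⊓ qPart θ, killingForm ℝ L E X = 0 →
    ε (𝔪.mkQ X) = 0
  apply_piece : ∀ i : ℤ, i ≠ 0 → ∀ v ∈ quotPiece 𝔪 Φ 𝔭 i, ε v = 0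

end LieAlgebraPart

/-- A form `w` on `V` of total degree `n = p + q` has degree `(p, q)` with respect to the subspaces
`V₁₀` and `V₀₁` if it vanishes upon insertion of `p + 1` vectors of `V₁₀` and upon insertion of
`q + 1` vectors of `V₀₁`. -/
def HasBidegree {V : Type*} [AddCommGroup V] [Module ℝ V] (V₁₀ V₀₁ : Submodule ℝ V) (p q : ℕ)
    {n : ℕ} (w : V [⋀^Fin n]→ₗ[ℝ] ℝ) : Prop :=
  n = p + q ∧
  ∀ (v : Fin n → V) (s : Finset (Fin n)),
    (p < s.card ∧ (∀ j ∈ s, v j ∈ V₁₀)) ∨ (q < s.card ∧ (∀ j ∈ s, v j ∈ V₀₁)) → w v = 0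

/-! ### Lie groups -/

section LieGroupPart

instance : ENat.LEInfty (minSmoothness ℝ 3) := by
  rw [minSmoothness_of_isRCLikeNormedField]
  infer_instance

variable {d : ℕ} {G : Type*} [TopologicalSpace G] [ChartedSpace (EuclideanSpace ℝ (Fin d)) G]
  [Group G]

instance (x : G) : FiniteDimensional ℝ (TangentSpace (𝓡 d) x) :=
  inferInstanceAs (FiniteDimensional ℝ (EuclideanSpace ℝ (Fin d)))

instance (x : G) : T2Space (TangentSpace (𝓡 d) x) :=
  inferInstanceAs (T2Space (EuclideanSpace ℝ (Fin d)))

/-- The Lie algebra `T_1 G`. -/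
abbrev Lie (d : ℕ) (G : Type*) [TopologicalSpace G]
    [ChartedSpace (EuclideanSpace ℝ (Fin d)) G] [Group G] : Type :=
  GroupLieAlgebra (𝓡 d) G

/-- The adjoint action `Ad(g)`: the derivative at `1` of `x ↦ g x g⁻¹`. -/
def Ad (g : G) : Lie d G →L[ℝ] Lie d G :=
  mfderiv (𝓡 d) (𝓡 d) (fun x : G => g * x * g⁻¹) 1

/-- The Lie algebra of a closed subgroup `H`: the initial velocities of the smooth one-parameter
subgroups of `G` that are contained in `H`. -/
def lieOfSubgroup (d : ℕ) {G : Type*} [TopologicalSpace G]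
    [ChartedSpace (EuclideanSpace ℝ (Fin d)) G] [Group G] (H : Subgroup G) : Set (Lie d G) :=
  {X | ∃ γ : ℝ → G, ContMDiff 𝓘(ℝ, ℝ) (𝓡 d) ∞ γ ∧ (∀ s t, γ (s + t) = γ s * γ t) ∧
    (∀ t, γ t ∈ H) ∧ X = mfderiv 𝓘(ℝ, ℝ) (𝓡 d) γ 0 (1 : ℝ)}

/-- A maximal compact subgroup. -/
def IsMaximalCompact (K : Subgroup G) : Prop :=
  IsCompact (K : Set G) ∧ ∀ K' : Subgroup G, IsCompact (K' : Set G) → K ≤ K' → K' = K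

/-- The exterior derivative at `x` of a differential form on the manifold `G`, computed in the
chart at `x`. -/
def extDerivAt {n : ℕ} (w : (x : G) → TangentSpace (𝓡 d) x [⋀^Fin n]→L[ℝ] ℝ) (x : G) :
    TangentSpace (𝓡 d) x [⋀^Fin (n + 1)]→L[ℝ] ℝ :=
  let e := extChartAt (𝓡 d) x
  let we : EuclideanSpace ℝ (Fin d) → EuclideanSpace ℝ (Fin d) [⋀^Fin n]→L[ℝ] ℝ := fun y =>
    (w (e.symm y)).compContinuousLinearMap (mfderiv (𝓡 d) (𝓡 d) e.symm y)
  (extDeriv we (e x)).compContinuousLinearMap (mfderiv (𝓡 d) (𝓡 d) e x)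

/-- Left translation `T_g G → T_1 G` by `g⁻¹`. -/
def toLie (g : G) : TangentSpace (𝓡 d) g →L[ℝ] Lie d G :=
  mfderiv (𝓡 d) (𝓡 d) (fun x : G => g⁻¹ * x) g

/-- The left invariant `1`-form on `G` that is determined by a covector `ε` on `𝔤/𝔪`. If `ε` is
`M`-invariant, this is the pullback to `G` of the corresponding `G`-invariant `1`-form on `G/M`. -/
def invariantOneForm (𝔪 : Submodule ℝ (Lie d G)) (ε : Dual ℝ (Lie d G ⧸ 𝔪)) (g : G) :
    TangentSpace (𝓡 d) g [⋀^Fin 1]→L[ℝ] ℝ :=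
  ContinuousAlternatingMap.ofSubsingleton ℝ (TangentSpace (𝓡 d) g) ℝ (0 : Fin 1)
    ((LinearMap.toContinuousLinearMap (ε ∘ₗ 𝔪.mkQ)).comp (toLie g))

/-- `η` is the element of `Λ²(𝔤/𝔪)^*` that corresponds to the exterior derivative of the invariant
`1`-form on `G/M` given by `ε`. Forms on `G/M` are identified with their pullbacks to `G`; pulling
back along `G → G/M` is injective and commutes with the exterior derivative. -/
def IsInvariantExtDeriv (𝔪 : Submodule ℝ (Lie d G)) (ε : Dual ℝ (Lie d G ⧸ 𝔪))
    (η : (Lie d G ⧸ 𝔪) [⋀^Fin 2]→ₗ[ℝ] ℝ) : Prop :=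
  ∀ (g : G) (v : Fin 2 → TangentSpace (𝓡 d) g),
    extDerivAt (invariantOneForm 𝔪 ε) g v = η (fun j => 𝔪.mkQ (toLie g (v j)))

/-- `dK` and `dP` are the `K`-derivative and the `P`-derivative of the form of degree `(1,0)` given
by `ε`: its exterior derivative is `dK + dP` with `dK` of degree `(2,0)` and `dP` of degree
`(1,1)`. -/
structure IsPartialDerivs (𝔪 : Submodule ℝ (Lie d G)) (V₁₀ V₀₁ : Submodule ℝ (Lie d G ⧸ 𝔪))
    (ε : Dual ℝ (Lie d G ⧸ 𝔪)) (dK dP : (Lie d G ⧸ 𝔪) [⋀^Fin 2]→ₗ[ℝ] ℝ) : Prop where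
  extDeriv_eq : IsInvariantExtDeriv 𝔪 ε (dK + dP)
  degree_K : HasBidegree V₁₀ V₀₁ 2 0 dK
  degree_P : HasBidegree V₁₀ V₀₁ 1 1 dP

/-- Standing assumptions on the subgroups `K`, `P` and the subspace `𝔪`: `K` is the maximal compact
subgroup with Lie algebra `𝔨`, `P` is a parabolic subgroup with Lie algebra `𝔭`, and `𝔪` is the
Lie algebra of `M = K ∩ P`. -/
structure IsGroupData [LieGroup (𝓡 d) ∞ G] (θ : Lie d G ≃ₗ⁅ℝ⁆ Lie d G)
    (𝔭 : LieSubalgebra ℝ (Lie d G)) (K P : Subgroup G) (𝔪 : Submodule ℝ (Lie d G)) : Prop where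
  maximalCompact : IsMaximalCompact K
  lie_K : lieOfSubgroup d K = (kPart θ : Set (Lie d G))
  isClosed_P : IsClosed (P : Set G)
  lie_P : lieOfSubgroup d P = (𝔭 : Set (Lie d G))
  lie_M : lieOfSubgroup d (K ⊓ P) = (𝔪 : Set (Lie d G))

end LieGroupPart

end PoissonTransform

end

noncomputable section

namespace PoissonTransform

/-! ### The Killing form, the Cartan inner product and joint eigenspaces -/

section CartanInvolution

variable {L : Type*} [LieRing L] [LieAlgebra ℝ L] {θ : L ≃ₗ⁅ℝ⁆ L}

/-! The covector is forced to be `B(E, ·) / B(E, E)`, and everything follows from one identity. The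
Maurer–Cartan equation (`extDerivAt_invariantOneForm`) gives `dE^*(X, Y) = -E^*([X, Y])`, and
invariance of `B` turns this into `-B([E, X], Y) / B(E, E)`.

Since `E` lies in `𝔮`, it is orthogonal to `𝔨`, so `E^*` descends to `𝔤/𝔪` and `dE^*` vanishes on `𝔨
× 𝔨`. Since `ad E` has only nonnegative eigenvalues on `𝔭`, and `B` pairs the eigenvalue `a` with
`-a` only, `dE^*` also vanishes on `𝔭 × 𝔭` (`killing_lie_E`). Thus `dE^*` has degree `(1, 1)`, the
`K`-derivative is zero, and on `𝔤_i` the `P`-derivative is a multiple of `B`. Pairing a vector with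
its image under `θ` gives nondegeneracy, because `-B(·, θ ·)` is positive definite.

Two points need real work. First, `𝔭` is only assumed to be a subalgebra containing `𝔭₀`; that it is
the sum of the eigenspaces of `ad E` with nonnegative eigenvalue rests on
`IsGradedParabolic.rootSpace_neg_le` and `eq_zero_of_mem_neg`. These are inductions over positive
roots in which norm computations replace the structure theory of root systems.

Second, `M` may be disconnected, so its invariance statements cannot be checked on `𝔪`. Instead
every automorphism preserving `𝔨` and `𝔭` is shown to fix `E` (`automorphism_E`): the image of `E`
lies in `𝔞`, dominates `E` on positive roots and has the same length. -/

lemma killing_comm (X Y : L) : killingForm ℝ L X Y = killingForm ℝ L Y X :=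
  LieModule.traceForm_comm ℝ L L X Y

lemma killing_lie_left (X Y Z : L) : killingForm ℝ L ⁅X, Y⁆ Z = killingForm ℝ L X ⁅Y, Z⁆ :=
  LieModule.traceForm_apply_lie_apply ℝ L L X Y Z

lemma killing_lie_left' (X Y Z : L) : killingForm ℝ L ⁅X, Y⁆ Z = -killingForm ℝ L Y ⁅X, Z⁆ :=
  LieModule.traceForm_apply_lie_apply' ℝ L L X Y Z

lemma killing_theta (θ : L ≃ₗ⁅ℝ⁆ L) (X Y : L) :
    killingForm ℝ L (θ X) (θ Y) = killingForm ℝ L X Y :=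
  LieAlgebra.killingForm_of_equiv_apply θ X Y

lemma mem_kPart {X : L} : X ∈ kPart θ ↔ θ X = X := Iff.rfl

lemma mem_qPart {X : L} : X ∈ qPart θ ↔ θ X = -X := Iff.rfl

lemma theta_eq_zero_iff {X : L} : θ X = 0 ↔ X = 0 :=
  EmbeddingLike.map_eq_zero_iff (f := θ)

lemma mem_rootSpace {𝔞 : Submodule ℝ L} {α : Dual ℝ 𝔞} {X : L} :
    X ∈ rootSpace 𝔞 α ↔ ∀ H : 𝔞, ⁅(H : L), X⁆ = α H • X := Iff.rfl

namespace IsCartanInvolution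

variable (hθ : IsCartanInvolution θ)

include hθ

lemma nonneg (X : L) : 0 ≤ -killingForm ℝ L X (θ X) := by
  by_cases h : X = 0
  · simp [h]
  · exact (hθ.posDef X h).le

lemma eq_zero_of_killing {X : L} (h : killingForm ℝ L X (θ X) = 0) : X = 0 := by
  by_contra hX
  have := hθ.posDef X hX
  simp [h] at this

lemma eq_zero_of_nonpos {X : L} (h : -killingForm ℝ L X (θ X) ≤ 0) : X = 0 :=
  hθ.eq_zero_of_killing (by linarith [hθ.nonneg X])

lemma killing_theta_right (X Y : L) : killingForm ℝ L X (θ Y) = killingForm ℝ L (θ X) Y := by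
  rw [← killing_theta θ X, hθ.involutive]

lemma theta_add_mem_kPart (X : L) : X + θ X ∈ kPart θ := by
  rw [mem_kPart, map_add, hθ.involutive, add_comm]

lemma sub_theta_mem_qPart (X : L) : X - θ X ∈ qPart θ := by
  rw [mem_qPart, map_sub, hθ.involutive, neg_sub]

omit hθ in
lemma _root_.PoissonTransform.killing_eq_zero_of_mem {X Y : L} (hX : X ∈ kPart θ) (hY : Y ∈ qPart θ) :
    killingForm ℝ L X Y = 0 := by
  have h := killing_theta θ X Y
  rw [mem_kPart.1 hX, mem_qPart.1 hY, map_neg] at h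
  linarith

/-- The positive definite inner product `(X, Y) ↦ -B(X, θ Y)`. -/
abbrev innerCore : InnerProductSpace.Core ℝ L where
  inner X Y := -killingForm ℝ L X (θ Y)
  conj_inner_symm X Y := by
    simp only [conj_trivial]
    rw [hθ.killing_theta_right, killing_comm]
  re_inner_nonneg X := by simpa using hθ.nonneg X
  add_left X Y Z := by simp [add_comm]
  smul_left X Y r := by simp
  definite X h := hθ.eq_zero_of_killing (by simpa using h)

/-- In a positive definite space, a proper inclusion of subspaces is detected by a nonzero
orthogonal vector. -/
lemma exists_orthogonal [FiniteDimensional ℝ L] {S T : Submodule ℝ L} (h : S ≤ T) (hne : ¬ T ≤ S) :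
    ∃ Y ∈ T, Y ≠ 0 ∧ ∀ s ∈ S, killingForm ℝ L s (θ Y) = 0 := by
  let _ := hθ.innerCore.toNormedAddCommGroup
  let _ : InnerProductSpace ℝ L := InnerProductSpace.ofCore hθ.innerCore.toCore
  obtain ⟨x, hxT, hxS⟩ := Set.not_subset.1 hne
  obtain ⟨s, hs, y, hy, rfl⟩ := S.exists_add_mem_mem_orthogonal x
  refine ⟨y, ?_, ?_, fun s hs => ?_⟩
  · simpa using T.sub_mem hxT (h hs)
  · rintro rfl
    exact hxS (by simpa using hs)
  · have := (Submodule.mem_orthogonal S y).1 hy s hs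
    exact neg_eq_zero.1 this

/-- A commuting family of `ad`-operators of elements of `𝔮` is simultaneously diagonalizable on
every invariant subspace. -/
lemma eq_iSup_inf_rootSpace [FiniteDimensional ℝ L] {𝔞 : Submodule ℝ L} (h𝔞 : 𝔞 ≤ qPart θ)
    (hab : IsAbelianSubspace 𝔞) (W : Submodule ℝ L) (hW : ∀ H ∈ 𝔞, ∀ X ∈ W, ⁅H, X⁆ ∈ W) :
    W = ⨆ α : Dual ℝ 𝔞, W ⊓ rootSpace 𝔞 α := by
  let _ := hθ.innerCore.toNormedAddCommGroup
  let _ : InnerProductSpace ℝ L := InnerProductSpace.ofCore hθ.innerCore.toCore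
  -- Since `θ H = -H`, the operator `ad H` is symmetric for `-B(·, θ ·)`, so the spectral theorem
  -- for commuting symmetric operators applies.
  have hsymm (H : 𝔞) : (LieAlgebra.ad ℝ L (H : L)).IsSymmetric := by
    intro X Y
    change -killingForm ℝ L ⁅(H : L), X⁆ (θ Y) = -killingForm ℝ L X (θ ⁅(H : L), Y⁆)
    rw [killing_lie_left', LieEquiv.map_lie, mem_qPart.1 (h𝔞 H.2), neg_lie, map_neg]
  have hmaps (H : 𝔞) : ∀ X ∈ W, LieAlgebra.ad ℝ L (H : L) X ∈ W := fun X hX => hW H H.2 X hX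
  let T : 𝔞 → W →ₗ[ℝ] W := fun H => (LieAlgebra.ad ℝ L (H : L)).restrict (hmaps H)
  have hT (H : 𝔞) : (T H).IsSymmetric := (hsymm H).restrict_invariant (hmaps H)
  have hcomm : Pairwise (Function.onFun Commute T) := by
    intro H H' _
    refine LinearMap.ext fun X => Subtype.ext ?_
    change ⁅(H : L), ⁅(H' : L), (X : L)⁆⁆ = ⁅(H' : L), ⁅(H : L), (X : L)⁆⁆
    rw [leibniz_lie, hab _ H.2 _ H'.2, zero_lie, zero_add]
  have htop := LinearMap.IsSymmetric.iSup_iInf_eq_top_of_commute hT hcomm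
  refine le_antisymm ?_ (iSup_le fun α => inf_le_left)
  have := congrArg (Submodule.map W.subtype) htop
  rw [Submodule.map_iSup, Submodule.map_top, Submodule.range_subtype] at this
  conv_lhs => rw [← this]
  refine iSup_le fun χ => ?_
  rintro _ ⟨X, hX, rfl⟩
  have hX' : ∀ H : 𝔞, ⁅(H : L), (X : L)⁆ = χ H • (X : L) := fun H => by
    have := Module.End.mem_eigenspace_iff.1 ((Submodule.mem_iInf _).1 hX H)
    exact congrArg Subtype.val this
  by_cases h0 : (X : L) = 0
  · simp [h0]
  have hinj : Function.Injective fun c : ℝ => c • (X : L) := smul_left_injective ℝ h0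
  -- The spectral theorem only yields a function `χ` of eigenvalues; a nonzero joint eigenvector
  -- forces it to be linear.
  let α : Dual ℝ 𝔞 :=
    { toFun := χ
      map_add' := fun H H' => hinj <| by
        change χ (H + H') • (X : L) = (χ H + χ H') • (X : L)
        rw [← hX', add_smul, ← hX', ← hX', Submodule.coe_add, add_lie]
      map_smul' := fun c H => hinj <| by
        change χ (c • H) • (X : L) = (c • χ H) • (X : L)
        rw [← hX', smul_assoc, ← hX', Submodule.coe_smul, smul_lie] }
  exact Submodule.mem_iSup_of_mem α ⟨X.2, hX'⟩

end IsCartanInvolution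

/-! ### Root spaces -/

section RootSpace

variable {𝔞 : Submodule ℝ L} {α β : Dual ℝ 𝔞} {X Y : L}

lemma lie_mem_rootSpace (hX : X ∈ rootSpace 𝔞 α) (hY : Y ∈ rootSpace 𝔞 β) :
    ⁅X, Y⁆ ∈ rootSpace 𝔞 (α + β) := fun H => by
  rw [leibniz_lie, hX H, hY H, smul_lie, lie_smul, LinearMap.add_apply, add_smul]

lemma theta_mem_rootSpace (h𝔞 : 𝔞 ≤ qPart θ) (hX : X ∈ rootSpace 𝔞 α) :
    θ X ∈ rootSpace 𝔞 (-α) := fun H => by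
  have h := congrArg θ (hX H)
  rw [LieEquiv.map_lie, mem_qPart.1 (h𝔞 H.2), map_smul, neg_lie] at h
  rw [LinearMap.neg_apply, neg_smul, ← h, neg_neg]

lemma killing_rootSpace (H : 𝔞) (hX : X ∈ rootSpace 𝔞 α) (hY : Y ∈ rootSpace 𝔞 β) :
    (α H + β H) * killingForm ℝ L X Y = 0 := by
  have h := killing_lie_left' (H : L) X Y
  rw [hX H, hY H, map_smul, map_smul, LinearMap.smul_apply, smul_eq_mul, smul_eq_mul] at h
  linarith

lemma neg_mem_restrictedRoots (h𝔞 : 𝔞 ≤ qPart θ)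
    (hα : α ∈ restrictedRoots 𝔞) : -α ∈ restrictedRoots 𝔞 := by
  obtain ⟨X, hX, hX0⟩ := Submodule.exists_mem_ne_zero_of_ne_bot hα.2
  exact ⟨neg_ne_zero.2 hα.1, Submodule.ne_bot_iff _ |>.2
    ⟨θ X, theta_mem_rootSpace h𝔞 hX, fun h => hX0 (theta_eq_zero_iff.1 h)⟩⟩

lemma iSupIndep_rootSpace (hab : IsAbelianSubspace 𝔞) : iSupIndep (rootSpace 𝔞) := by
  have hcomm (H H' : 𝔞) : Commute (LieAlgebra.ad ℝ L (H : L)) (LieAlgebra.ad ℝ L (H' : L)) := by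
    refine LinearMap.ext fun X => ?_
    change ⁅(H : L), ⁅(H' : L), X⁆⁆ = ⁅(H' : L), ⁅(H : L), X⁆⁆
    rw [leibniz_lie, hab _ H.2 _ H'.2, zero_lie, zero_add]
  have h := Module.End.independent_iInf_maxGenEigenspace_of_forall_mapsTo
    (fun H : 𝔞 => (LieAlgebra.ad ℝ L (H : L)))
    (fun i j φ => Module.End.mapsTo_maxGenEigenspace_of_comm (hcomm j i) φ)
  refine (h.comp (f := fun α : Dual ℝ 𝔞 => (α : 𝔞 → ℝ)) DFunLike.coe_injective).mono
    fun α X hX => (Submodule.mem_iInf _).2 fun H => ?_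
  exact Module.End.mem_maxGenEigenspace _ _ _ |>.2
    ⟨1, by simpa [sub_eq_zero] using mem_rootSpace.1 hX H⟩

lemma finite_rootSpace_ne_bot [FiniteDimensional ℝ L] (hab : IsAbelianSubspace 𝔞) :
    {α : Dual ℝ 𝔞 | rootSpace 𝔞 α ≠ ⊥}.Finite :=
  WellFoundedGT.finite_ne_bot_of_iSupIndep (iSupIndep_rootSpace hab)

lemma finite_restrictedRoots [FiniteDimensional ℝ L] (hab : IsAbelianSubspace 𝔞) :
    (restrictedRoots 𝔞).Finite :=
  (finite_rootSpace_ne_bot hab).subset fun _ h => h.2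

lemma iSup_rootSpace [FiniteDimensional ℝ L] (hθ : IsCartanInvolution θ) (h𝔞 : 𝔞 ≤ qPart θ)
    (hab : IsAbelianSubspace 𝔞) : ⨆ α, rootSpace 𝔞 α = ⊤ := by
  simpa using (hθ.eq_iSup_inf_rootSpace h𝔞 hab ⊤ (by simp)).symm

/-- The trace form of two elements of `𝔞` is nonnegative as soon as the products of their
eigenvalues are. -/
lemma killing_nonneg_of_forall [FiniteDimensional ℝ L] (hθ : IsCartanInvolution θ)
    (h𝔞 : 𝔞 ≤ qPart θ) (hab : IsAbelianSubspace 𝔞) (H H' : 𝔞)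
    (h : ∀ α, rootSpace 𝔞 α ≠ ⊥ → 0 ≤ α H * α H') :
    0 ≤ killingForm ℝ L (H : L) (H' : L) := by
  classical
  rw [killingForm_apply_apply]
  have hint : DirectSum.IsInternal (rootSpace 𝔞) :=
    (DirectSum.isInternal_submodule_iff_iSupIndep_and_iSup_eq_top _).2
      ⟨iSupIndep_rootSpace hab, iSup_rootSpace hθ h𝔞 hab⟩
  have hmap (α : Dual ℝ 𝔞) : ∀ X ∈ rootSpace 𝔞 α,
      (LieAlgebra.ad ℝ L (H : L) ∘ₗ LieAlgebra.ad ℝ L (H' : L)) X = (α H * α H') • X := by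
    intro X hX
    simp only [LinearMap.comp_apply, LieAlgebra.ad_apply]
    rw [hX H', lie_smul, hX H, smul_smul, mul_comm]
  have hmaps (α : Dual ℝ 𝔞) : Set.MapsTo
      (LieAlgebra.ad ℝ L (H : L) ∘ₗ LieAlgebra.ad ℝ L (H' : L))
      (rootSpace 𝔞 α) (rootSpace 𝔞 α) := fun X hX => by
    rw [hmap α X hX]
    exact Submodule.smul_mem _ _ hX
  rw [LinearMap.trace_eq_sum_trace_restrict' hint (finite_rootSpace_ne_bot hab) hmaps]
  refine Finset.sum_nonneg fun α hα => ?_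
  have : (LieAlgebra.ad ℝ L (H : L) ∘ₗ LieAlgebra.ad ℝ L (H' : L)).restrict (hmaps α) =
      (α H * α H') • LinearMap.id :=
    LinearMap.ext fun X => Subtype.ext (hmap α X X.2)
  rw [this, map_smul, LinearMap.trace_id, smul_eq_mul]
  exact mul_nonneg (h α (by simpa using hα)) (Nat.cast_nonneg _)

end RootSpace

end CartanInvolution

/-! ### Restricted roots and norm computations with root vectors -/

section RestrictedRoots

variable {L : Type*} [LieRing L] [LieAlgebra ℝ L] {θ : L ≃ₗ⁅ℝ⁆ L} {𝔞 : Submodule ℝ L}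
  {α β : Dual ℝ 𝔞}

/-- A maximal abelian subspace of `𝔮` is its own centralizer in `𝔮`. -/
lemma IsMaximalAbelian.mem_of_commute (h𝔞 : IsMaximalAbelian θ 𝔞) {X : L} (hq : X ∈ qPart θ)
    (h0 : X ∈ rootSpace 𝔞 0) : X ∈ 𝔞 := by
  have h0' : ∀ H ∈ 𝔞, ⁅H, X⁆ = 0 := fun H hH => by simpa using h0 ⟨H, hH⟩
  have h0'' : ∀ H ∈ 𝔞, ⁅X, H⁆ = 0 := fun H hH => by rw [← lie_skew, h0' H hH, neg_zero]
  have h := h𝔞.maximal (𝔞 ⊔ Submodule.span ℝ {X})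
    (sup_le h𝔞.le_q (by simpa using hq)) ?_ le_sup_left
  · rw [← h]
    exact Submodule.mem_sup_right (Submodule.mem_span_singleton_self X)
  · intro Y hY Z hZ
    obtain ⟨y, hy, _, hy', rfl⟩ := Submodule.mem_sup.1 hY
    obtain ⟨z, hz, _, hz', rfl⟩ := Submodule.mem_sup.1 hZ
    obtain ⟨a, rfl⟩ := Submodule.mem_span_singleton.1 hy'
    obtain ⟨b, rfl⟩ := Submodule.mem_span_singleton.1 hz'
    simp [h𝔞.abelian y hy z hz, h0' y hy, h0'' z hz]

lemma rootSpace_zero_le_sup (hθ : IsCartanInvolution θ) (h𝔞 : IsMaximalAbelian θ 𝔞) :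
    rootSpace 𝔞 0 ≤ mZero θ 𝔞 ⊔ 𝔞 := by
  intro X hX
  have hθX : θ X ∈ rootSpace 𝔞 0 := by simpa using theta_mem_rootSpace h𝔞.le_q hX
  refine Submodule.mem_sup.2 ⟨(2⁻¹ : ℝ) • (X + θ X), ?_, (2⁻¹ : ℝ) • (X - θ X), ?_, ?_⟩
  · exact Submodule.smul_mem _ _ ⟨hθ.theta_add_mem_kPart X, Submodule.add_mem _ hX hθX⟩
  · exact Submodule.smul_mem _ _
      (h𝔞.mem_of_commute (hθ.sub_theta_mem_qPart X) (Submodule.sub_mem _ hX hθX))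
  · module

/-- The element `⁅U, θ U⁆` of a vector `U` in the root space of `-β` is the positive multiple
`-B(U, θ U)` of the element of `𝔞` representing `β`. -/
lemma lie_theta_mem (hθ : IsCartanInvolution θ) (h𝔞 : IsMaximalAbelian θ 𝔞) {U : L}
    (hU : U ∈ rootSpace 𝔞 (-β)) : ⁅U, θ U⁆ ∈ 𝔞 := by
  refine h𝔞.mem_of_commute ?_ ?_
  · rw [mem_qPart, LieEquiv.map_lie, hθ.involutive, lie_skew]
  · simpa using lie_mem_rootSpace hU (theta_mem_rootSpace h𝔞.le_q hU)

lemma killing_lie_theta (h𝔞 : IsMaximalAbelian θ 𝔞) {U : L} (hU : U ∈ rootSpace 𝔞 (-β)) (H : 𝔞) :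
    killingForm ℝ L ⁅U, θ U⁆ H = β H * -killingForm ℝ L U (θ U) := by
  have h := theta_mem_rootSpace h𝔞.le_q hU H
  rw [neg_neg] at h
  rw [killing_lie_left, ← lie_skew, h, map_neg, map_smul, smul_eq_mul, mul_neg]

/-- For the inner product `-B(·, θ ·)` the adjoint of `ad (θ U)` is `-ad U`, and `[U, Z] = 0`
reduces `[U, [θ U, Z]]` to `[[U, θ U], Z]` by the Jacobi identity. This takes the place of
`𝔰𝔩₂`-theory below. -/
lemma norm_lie_theta (hθ : IsCartanInvolution θ) {U Z : L} (hUZ : ⁅U, Z⁆ = 0) :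
    -killingForm ℝ L ⁅θ U, Z⁆ (θ ⁅θ U, Z⁆) = killingForm ℝ L ⁅⁅U, θ U⁆, Z⁆ (θ Z) := by
  rw [LieEquiv.map_lie, hθ.involutive, ← killing_lie_left, ← lie_skew, map_neg,
    LinearMap.neg_apply, neg_neg, leibniz_lie, hUZ, lie_zero, add_zero]

/-- If the root vector `U` for `-β` commutes with the root vector `Z` for `α`, then
`|⁅θ U, Z⁆|² = -α(⁅U, θ U⁆) |Z|²`. -/
lemma norm_lie_theta_rootSpace (hθ : IsCartanInvolution θ) (h𝔞 : IsMaximalAbelian θ 𝔞) {U Z : L}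
    (hU : U ∈ rootSpace 𝔞 (-β)) (hZ : Z ∈ rootSpace 𝔞 α) (hUZ : ⁅U, Z⁆ = 0) :
    -killingForm ℝ L ⁅θ U, Z⁆ (θ ⁅θ U, Z⁆) =
      -(α ⟨⁅U, θ U⁆, lie_theta_mem hθ h𝔞 hU⟩ * -killingForm ℝ L Z (θ Z)) := by
  have h := hZ ⟨⁅U, θ U⁆, lie_theta_mem hθ h𝔞 hU⟩
  simp only at h
  rw [norm_lie_theta hθ hUZ, h, map_smul, LinearMap.smul_apply, smul_eq_mul]
  ring

/-- `[X, θ X]` is a positive multiple of the vector representing `α`, so `α([X, θ X]) |X|² = |[X, θ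
X]|²`. If this were not positive, `[X, θ X]` would vanish and `α` with it. -/
lemma apply_lie_theta_pos (hθ : IsCartanInvolution θ) (h𝔞 : IsMaximalAbelian θ 𝔞) {X : L}
    (hα : α ≠ 0) (hX : X ∈ rootSpace 𝔞 (-α)) (hX0 : X ≠ 0) :
    0 < α ⟨⁅X, θ X⁆, lie_theta_mem hθ h𝔞 hX⟩ := by
  have hXX := hθ.posDef X hX0
  by_contra! hle
  have h1 := killing_lie_theta h𝔞 hX ⟨⁅X, θ X⁆, lie_theta_mem hθ h𝔞 hX⟩
  have h0 : ⁅X, θ X⁆ = 0 := by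
    refine hθ.eq_zero_of_nonpos ?_
    rw [mem_qPart.1 (h𝔞.le_q (lie_theta_mem hθ h𝔞 hX)), map_neg, neg_neg, h1]
    exact mul_nonpos_of_nonpos_of_nonneg hle hXX.le
  refine hα (LinearMap.ext fun H => ?_)
  have h2 := killing_lie_theta h𝔞 hX H
  rw [h0, map_zero, LinearMap.zero_apply, zero_eq_mul] at h2
  exact h2.resolve_right hXX.ne'

/-- A nonzero root vector `X` for `-α` carries the root space of `α` onto the one of `-α` by
`(ad X)²`. -/
lemma rootSpace_neg_le_of_mem [FiniteDimensional ℝ L] (hθ : IsCartanInvolution θ)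
    (h𝔞 : IsMaximalAbelian θ 𝔞) (hα : α ≠ 0) {X : L} (hX : X ∈ rootSpace 𝔞 (-α)) (hX0 : X ≠ 0)
    {Y : L} (hY : Y ∈ rootSpace 𝔞 (-α)) : ∃ W ∈ rootSpace 𝔞 α, ⁅X, ⁅X, W⁆⁆ = Y := by
  have hpos := apply_lie_theta_pos hθ h𝔞 hα hX hX0
  have hmem : ∀ W ∈ rootSpace 𝔞 α, ⁅X, ⁅X, W⁆⁆ ∈ rootSpace 𝔞 (-α) := fun W hW => by
    simpa using lie_mem_rootSpace hX (lie_mem_rootSpace hX hW)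
  have hθmem : ∀ Z ∈ rootSpace 𝔞 (-α), θ Z ∈ rootSpace 𝔞 α := fun Z hZ => by
    simpa using theta_mem_rootSpace h𝔞.le_q hZ
  -- Put `u = [X, W]`, which commutes with `𝔞`. The norm identity with weight `0` gives `[θ X, u] =
  -- 0`, and moving `ad X` across `B` then gives `u = 0`. Applied to `W`, the same identity equates
  -- a nonnegative number with `-α([X, θ X]) |W|²`, so `W = 0`.
  have hinj : ∀ W ∈ rootSpace 𝔞 α, ⁅X, ⁅X, W⁆⁆ = 0 → W = 0 := by
    intro W hW hXXW
    have hu : ⁅X, W⁆ ∈ rootSpace 𝔞 0 := by simpa using lie_mem_rootSpace hX hW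
    have h1 : ⁅θ X, ⁅X, W⁆⁆ = 0 := hθ.eq_zero_of_nonpos <| by
      rw [norm_lie_theta_rootSpace hθ h𝔞 hX hu hXXW]
      simp
    have h2 : ⁅X, W⁆ = 0 := hθ.eq_zero_of_killing <| by
      rw [killing_lie_left', ← hθ.involutive X, ← LieEquiv.map_lie, hθ.involutive, h1]
      simp
    refine hθ.eq_zero_of_nonpos ?_
    have h3 := norm_lie_theta_rootSpace hθ h𝔞 hX hW h2
    have h4 := hθ.nonneg ⁅θ X, W⁆
    rw [h3] at h4
    by_contra! h5
    have := mul_pos hpos h5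
    linarith
  -- Precomposing `(ad X)²` with `θ` gives an injective endomorphism of one finite-dimensional
  -- space, hence a surjective one; no comparison of dimensions is needed.
  let f : rootSpace 𝔞 (-α) →ₗ[ℝ] rootSpace 𝔞 (-α) :=
    ((LieAlgebra.ad ℝ L X ∘ₗ LieAlgebra.ad ℝ L X) ∘ₗ (θ : L →ₗ[ℝ] L)).restrict
      fun Z hZ => hmem _ (hθmem Z hZ)
  have hf : Function.Injective f := by
    rw [← LinearMap.ker_eq_bot, LinearMap.ker_eq_bot']
    intro Z hZ
    have h := hinj (θ Z) (hθmem Z Z.2) (congrArg Subtype.val hZ)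
    exact Subtype.ext (theta_eq_zero_iff.1 h)
  obtain ⟨Z, hZ⟩ := LinearMap.surjective_of_injective hf ⟨Y, hY⟩
  exact ⟨θ Z, hθmem Z Z.2, congrArg Subtype.val hZ⟩

variable {Φ : Set (Dual ℝ 𝔞)}

lemma IsPositiveSystem.mem_restrictedRoots (hΦ : IsPositiveSystem 𝔞 Φ) (hα : α ∈ Φ) :
    α ∈ restrictedRoots 𝔞 := by
  obtain ⟨H₀, -, rfl⟩ := hΦ
  exact hα.1

lemma IsPositiveSystem.mem_or_neg_mem (hΦ : IsPositiveSystem 𝔞 Φ) (h𝔞 : IsMaximalAbelian θ 𝔞)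
    (hα : α ∈ restrictedRoots 𝔞) : α ∈ Φ ∨ -α ∈ Φ := by
  obtain ⟨H₀, h, rfl⟩ := hΦ
  rcases lt_or_gt_of_ne (h α hα) with h' | h'
  · exact Or.inr ⟨neg_mem_restrictedRoots h𝔞.le_q hα, by simpa using h'⟩
  · exact Or.inl ⟨hα, h'⟩

/-- Induction over the positive roots, with respect to addition of positive roots. -/
lemma IsPositiveSystem.induction [FiniteDimensional ℝ L] (hΦ : IsPositiveSystem 𝔞 Φ)
    (h𝔞 : IsMaximalAbelian θ 𝔞) {p : Dual ℝ 𝔞 → Prop}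
    (h : ∀ α ∈ Φ, (∀ β ∈ Φ, α - β ∈ Φ → p β) → p α) : ∀ α ∈ Φ, p α := by
  obtain ⟨H₀, -, rfl⟩ := hΦ
  by_contra! hex
  have hfin : {α ∈ {α ∈ restrictedRoots 𝔞 | 0 < α H₀} | ¬ p α}.Finite :=
    (finite_restrictedRoots h𝔞.abelian).subset fun α hα => hα.1.1
  -- Among the finitely many counterexamples, choose one with least value at the regular element
  -- `H₀`; positive summands have strictly smaller value.
  obtain ⟨α, hα, hmin⟩ := hfin.exists_minimalFor (fun α => α H₀) _ hex
  refine hα.2 (h α hα.1 fun β hβ hαβ => ?_)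
  by_contra hp
  have := hmin ⟨hβ, hp⟩
  have hlt := hαβ.2
  simp only [LinearMap.sub_apply] at this hlt
  linarith [this (by linarith)]

lemma IsPositiveSystem.simple_induction [FiniteDimensional ℝ L] (hΦ : IsPositiveSystem 𝔞 Φ)
    (h𝔞 : IsMaximalAbelian θ 𝔞) {p : Dual ℝ 𝔞 → Prop} (hs : ∀ α ∈ simpleRoots Φ, p α)
    (hadd : ∀ α ∈ Φ, ∀ β ∈ Φ, p α → p β → p (α + β)) : ∀ α ∈ Φ, p α := by
  refine hΦ.induction h𝔞 fun α hα ih => ?_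
  by_cases h : α ∈ simpleRoots Φ
  · exact hs α h
  · have : ∃ β ∈ Φ, ∃ γ ∈ Φ, α = β + γ := by
      by_contra! h'
      exact h ⟨hα, h'⟩
    obtain ⟨β, hβ, γ, hγ, rfl⟩ := this
    exact hadd β hβ γ hγ (ih β hβ (by simpa using hγ)) (ih γ hγ (by simpa using hβ))

/-- Otherwise `β - α` would be positive and `β = α + (β - α)` would decompose the simple root `β`.
-/
lemma IsPositiveSystem.sub_mem (hΦ : IsPositiveSystem 𝔞 Φ) (h𝔞 : IsMaximalAbelian θ 𝔞)
    (hα : α ∈ Φ) (hβ : β ∈ simpleRoots Φ) (hne : α ≠ β) (h : rootSpace 𝔞 (α - β) ≠ ⊥) :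
    α - β ∈ Φ := by
  refine (hΦ.mem_or_neg_mem h𝔞 ⟨sub_ne_zero.2 hne, h⟩).resolve_right fun h' => ?_
  exact hβ.2 α hα _ h' (by abel)

/-- A root vector for the negative of a positive root that is not simple is moved by a simple
root vector. -/
lemma IsPositiveSystem.exists_lie_ne_zero [FiniteDimensional ℝ L] (hΦ : IsPositiveSystem 𝔞 Φ)
    (hθ : IsCartanInvolution θ) (h𝔞 : IsMaximalAbelian θ 𝔞) (hα : α ∈ Φ)
    (hns : α ∉ simpleRoots Φ) {X : L} (hX : X ∈ rootSpace 𝔞 (-α)) (hX0 : X ≠ 0) :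
    ∃ β ∈ simpleRoots Φ, α - β ∈ Φ ∧ ∃ U ∈ rootSpace 𝔞 β, ⁅U, X⁆ ≠ 0 := by
  by_contra! hcon
  have hzero : ∀ β ∈ simpleRoots Φ, ∀ U ∈ rootSpace 𝔞 β, ⁅U, X⁆ = 0 := by
    intro β hβ U hU
    by_contra hne
    refine hne (hcon β hβ (hΦ.sub_mem h𝔞 hα hβ (fun h => hns (h ▸ hβ)) ?_) U hU)
    have h1 := theta_mem_rootSpace h𝔞.le_q (lie_mem_rootSpace hU hX)
    rw [show -(β + -α) = α - β by abel] at h1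
    exact (Submodule.ne_bot_iff _).2 ⟨_, h1, fun h => hne (theta_eq_zero_iff.1 h)⟩
  -- If all simple root vectors kill `X`, the norm identity gives `α([V, θ V]) ≤ 0` for `V` in the
  -- root space of `-β`, `β` simple. Symmetry of `B` on `[V, θ V]` and `[X, θ X]` converts this to
  -- `β([X, θ X]) ≤ 0`, which extends to all positive roots and contradicts `α([X, θ X]) > 0`.
  set HX : 𝔞 := ⟨⁅X, θ X⁆, lie_theta_mem hθ h𝔞 hX⟩ with hHX
  have hle : ∀ β ∈ Φ, β HX ≤ 0 := by
    refine hΦ.simple_induction h𝔞 (fun β hβ => ?_) fun β _ γ _ hβ hγ => ?_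
    · obtain ⟨V, hV, hV0⟩ := Submodule.exists_mem_ne_zero_of_ne_bot
        (neg_mem_restrictedRoots h𝔞.le_q (hΦ.mem_restrictedRoots hβ.1)).2
      have hVX : ⁅V, θ X⁆ = 0 := by
        have h := hzero β hβ (θ V) (by simpa using theta_mem_rootSpace h𝔞.le_q hV)
        rw [← hθ.involutive V, ← LieEquiv.map_lie, h, map_zero]
      have hθX : θ X ∈ rootSpace 𝔞 α := by simpa using theta_mem_rootSpace h𝔞.le_q hX
      have h1 := norm_lie_theta_rootSpace hθ h𝔞 hV hθX hVX
      have h2 := hθ.nonneg ⁅θ V, θ X⁆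
      rw [h1, killing_theta] at h2
      set HV : 𝔞 := ⟨⁅V, θ V⁆, lie_theta_mem hθ h𝔞 hV⟩ with hHV
      have h3 := killing_lie_theta h𝔞 hV HX
      have h4 := killing_lie_theta h𝔞 hX HV
      simp only [hHX, hHV] at h3 h4
      rw [killing_comm, h4] at h3
      by_contra! hpos
      have h5 := mul_pos hpos (hθ.posDef V hV0)
      rw [← h3] at h5
      linarith
    · rw [LinearMap.add_apply]
      linarith
  exact (apply_lie_theta_pos hθ h𝔞 (hΦ.mem_restrictedRoots hα).1 hX hX0).not_ge (hle α hα)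

/-- The negative root spaces are generated by the negative simple ones. -/
lemma IsPositiveSystem.rootSpace_neg_le [FiniteDimensional ℝ L] (hΦ : IsPositiveSystem 𝔞 Φ)
    (hθ : IsCartanInvolution θ) (h𝔞 : IsMaximalAbelian θ 𝔞) (hα : α ∈ Φ)
    (hns : α ∉ simpleRoots Φ) {W : Submodule ℝ L}
    (hW : ∀ β ∈ simpleRoots Φ, α - β ∈ Φ → ∀ U ∈ rootSpace 𝔞 (-β),
      ∀ V ∈ rootSpace 𝔞 (-(α - β)), ⁅U, V⁆ ∈ W) : rootSpace 𝔞 (-α) ≤ W := by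
  by_contra hne
  obtain ⟨Y, hY, hY0, horth⟩ := hθ.exists_orthogonal
    (inf_le_right : W ⊓ rootSpace 𝔞 (-α) ≤ rootSpace 𝔞 (-α)) fun h => hne (h.trans inf_le_left)
  obtain ⟨β, hβ, hαβ, U, hU, hUY⟩ := hΦ.exists_lie_ne_zero hθ h𝔞 hα hns hY hY0
  have hV := lie_mem_rootSpace hU hY
  rw [show β + -α = -(α - β) by abel] at hV
  -- The vector `[θ U, [U, Y]]` lies in `W`, so it is orthogonal to `Y`; but its inner product with
  -- `Y` is `-|[U, Y]|²`.
  have hθU := theta_mem_rootSpace h𝔞.le_q hU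
  have hmem := lie_mem_rootSpace hθU hV
  rw [show -β + -(α - β) = -α by abel] at hmem
  have h := horth _ ⟨hW β hβ hαβ _ hθU _ hV, hmem⟩
  rw [killing_lie_left', ← LieEquiv.map_lie, neg_eq_zero] at h
  exact hUY (hθ.eq_zero_of_killing h)

end RestrictedRoots

/-! ### The grading element and the roots of a standard parabolic -/

section Parabolic

variable {L : Type*} [LieRing L] [LieAlgebra ℝ L]

/-- A standard parabolic `𝔭` of a real semisimple Lie algebra, together with the grading element
`E` of the grading it induces. -/
structure IsGradedParabolic (θ : L ≃ₗ⁅ℝ⁆ L) (𝔞 : Submodule ℝ L) (Φ : Set (Dual ℝ 𝔞))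
    (𝔭 : LieSubalgebra ℝ L) (E : L) : Prop where
  cartan : IsCartanInvolution θ
  maximal : IsMaximalAbelian θ 𝔞
  positive : IsPositiveSystem 𝔞 Φ
  pZero_le : pZero θ 𝔞 Φ ≤ 𝔭.toSubmodule
  grading : IsGradingElement Φ 𝔭 E

namespace IsGradedParabolic

variable {θ : L ≃ₗ⁅ℝ⁆ L} {𝔞 : Submodule ℝ L} {Φ : Set (Dual ℝ 𝔞)} {𝔭 : LieSubalgebra ℝ L} {E : L}
  (h : IsGradedParabolic θ 𝔞 Φ 𝔭 E) {α β : Dual ℝ 𝔞} {X Y : L} {i : ℤ}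

omit [LieAlgebra ℝ L] in
lemma _root_.PoissonTransform.lie_eq_zero_symm (hXY : ⁅X, Y⁆ = 0) :
    ⁅Y, X⁆ = 0 := by
  rw [← lie_skew, hXY, neg_zero]

lemma _root_.PoissonTransform.rootSpace_le_gradingPiece (c : Dual ℝ 𝔞 →₀ ℤ)
    (hc : (c.support : Set (Dual ℝ 𝔞)) ⊆ simpleRoots Φ) :
    rootSpace 𝔞 (c.sum fun α k => k • α) ≤ gradingPiece Φ 𝔭 (sigmaHeight Φ 𝔭 c) :=
  le_iSup_of_le c <| le_iSup_of_le hc <| le_iSup_of_le rfl le_rfl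

lemma _root_.PoissonTransform.rootSpace_zero_le_gradingPiece :
    rootSpace 𝔞 0 ≤ gradingPiece Φ 𝔭 0 := by
  simpa [sigmaHeight] using rootSpace_le_gradingPiece (Φ := Φ) (𝔭 := 𝔭) 0 (by simp)

lemma _root_.PoissonTransform.IsMaximalAbelian.le_rootSpace_zero (h𝔞 : IsMaximalAbelian θ 𝔞) :
    𝔞 ≤ rootSpace 𝔞 0 := fun X hX H => by
  simpa using h𝔞.abelian H H.2 X hX

include h

lemma commute_E (hX : X ∈ 𝔞) : ⁅X, E⁆ = 0 :=
  lie_eq_zero_symm (h.grading.central X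
    (rootSpace_zero_le_gradingPiece (h.maximal.le_rootSpace_zero hX)))

lemma exists_finsupp [FiniteDimensional ℝ L] (hα : rootSpace 𝔞 α ≠ ⊥) :
    ∃ c : Dual ℝ 𝔞 →₀ ℤ, (c.support : Set (Dual ℝ 𝔞)) ⊆ simpleRoots Φ ∧
      (c.sum fun α k => k • α) = α := by
  classical
  have hpos : ∀ α ∈ Φ, ∃ c : Dual ℝ 𝔞 →₀ ℤ, (c.support : Set (Dual ℝ 𝔞)) ⊆ simpleRoots Φ ∧
      (c.sum fun α k => k • α) = α := by
    refine h.positive.simple_induction h.maximal (fun α hα => ?_) ?_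
    · exact ⟨Finsupp.single α 1, fun β hβ => by
        rwa [Finset.mem_singleton.1 (Finsupp.support_single_subset hβ)], by simp⟩
    · rintro α - β - ⟨c, hc, hcα⟩ ⟨e, he, heβ⟩
      refine ⟨c + e, fun γ hγ => ?_, ?_⟩
      · rcases Finset.mem_union.1 (Finsupp.support_add hγ) with h' | h'
        exacts [hc h', he h']
      · rw [Finsupp.sum_add_index' (by simp) (by simp [add_smul]), hcα, heβ]
  by_cases h0 : α = 0
  · exact ⟨0, by simp, by simp [h0]⟩
  rcases h.positive.mem_or_neg_mem h.maximal ⟨h0, hα⟩ with h' | h'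
  · exact hpos α h'
  · obtain ⟨c, hc, hcα⟩ := hpos _ h'
    refine ⟨-c, by simpa using hc, ?_⟩
    rw [Finsupp.sum_neg_index (by simp)]
    rw [← neg_neg α, ← hcα, Finsupp.sum, Finsupp.sum, ← Finset.sum_neg_distrib]
    simp

lemma exists_rootSpace_le_gradingPiece [FiniteDimensional ℝ L] (hα : rootSpace 𝔞 α ≠ ⊥) :
    ∃ i : ℤ, rootSpace 𝔞 α ≤ gradingPiece Φ 𝔭 i := by
  obtain ⟨c, hc, rfl⟩ := h.exists_finsupp hα
  exact ⟨_, rootSpace_le_gradingPiece c hc⟩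

lemma induction_rootSpace [FiniteDimensional ℝ L] {p : L → Prop}
    (hroot : ∀ α, ∀ X ∈ rootSpace 𝔞 α, p X) (hadd : ∀ X Y, p X → p Y → p (X + Y)) (X : L) :
    p X := by
  have hX : X ∈ ⨆ α, rootSpace 𝔞 α := by
    rw [iSup_rootSpace h.cartan h.maximal.le_q h.maximal.abelian]
    trivial
  exact Submodule.iSup_induction _ (motive := p) hX hroot (hroot 0 0 (Submodule.zero_mem _)) hadd

/-- `θ` exchanges the root spaces of `α` and `-α`, hence negates heights, so `E + θ E` acts
trivially on every root space. An element with `ad = 0` is `B`-orthogonal to everything, hence zero.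
-/
lemma E_mem_qPart [FiniteDimensional ℝ L] : E ∈ qPart θ := by
  have hzero : ∀ X : L, ⁅E + θ E, X⁆ = 0 := by
    refine h.induction_rootSpace (fun α X hX => ?_) fun X Y hX hY => by
      rw [lie_add, hX, hY, add_zero]
    by_cases hX0 : X = 0
    · simp [hX0]
    have hθX : θ X ∈ rootSpace 𝔞 (-α) := theta_mem_rootSpace h.maximal.le_q hX
    obtain ⟨c, hc, hcα⟩ := h.exists_finsupp ((Submodule.ne_bot_iff _).2 ⟨X, hX, hX0⟩)
    have hXi := h.grading.lie_eq _ X (rootSpace_le_gradingPiece c hc (by rwa [hcα]))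
    have hcn : ((-c).sum fun α (k : ℤ) => k • α) = -α := by
      rw [Finsupp.sum_neg_index (by simp), ← hcα, Finsupp.sum, Finsupp.sum,
        ← Finset.sum_neg_distrib]
      simp
    have hsn : sigmaHeight Φ 𝔭 (-c) = -sigmaHeight Φ 𝔭 c := by
      classical
      simp only [sigmaHeight]
      rw [Finsupp.sum_neg_index (by simp), Finsupp.sum, Finsupp.sum, ← Finset.sum_neg_distrib]
      exact Finset.sum_congr rfl fun β _ => by split_ifs <;> simp
    have hθXi := h.grading.lie_eq _ (θ X)
      (rootSpace_le_gradingPiece (-c) (by simpa using hc) (by rwa [hcn]))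
    have h2 := congrArg θ hθXi
    rw [LieEquiv.map_lie, map_smul, h.cartan.involutive, hsn] at h2
    rw [add_lie, hXi, h2, ← add_smul]
    simp
  have h1 : E + θ E = 0 := by
    refine h.cartan.eq_zero_of_killing ?_
    have : LieAlgebra.ad ℝ L (E + θ E) = 0 := LinearMap.ext hzero
    rw [killingForm_apply_apply, this, LinearMap.zero_comp, map_zero]
  exact mem_qPart.2 (eq_neg_of_add_eq_zero_right h1)

lemma E_mem [FiniteDimensional ℝ L] : E ∈ 𝔞 :=
  h.maximal.mem_of_commute h.E_mem_qPart fun H => by simpa using h.commute_E H.2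

lemma theta_E [FiniteDimensional ℝ L] : θ E = -E := h.E_mem_qPart

lemma lie_E [FiniteDimensional ℝ L] (hX : X ∈ rootSpace 𝔞 α) : ⁅E, X⁆ = α ⟨E, h.E_mem⟩ • X :=
  hX ⟨E, h.E_mem⟩

lemma apply_E_eq [FiniteDimensional ℝ L] (hα : rootSpace 𝔞 α ≠ ⊥)
    (hle : rootSpace 𝔞 α ≤ gradingPiece Φ 𝔭 i) : α ⟨E, h.E_mem⟩ = i := by
  obtain ⟨X, hX, hX0⟩ := Submodule.exists_mem_ne_zero_of_ne_bot hα
  exact smul_left_injective ℝ hX0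
    ((h.lie_E hX).symm.trans (h.grading.lie_eq i X (hle hX)))

lemma exists_int_apply_E [FiniteDimensional ℝ L] (hα : rootSpace 𝔞 α ≠ ⊥) :
    ∃ i : ℤ, α ⟨E, h.E_mem⟩ = i ∧ rootSpace 𝔞 α ≤ gradingPiece Φ 𝔭 i := by
  obtain ⟨i, hi⟩ := h.exists_rootSpace_le_gradingPiece hα
  exact ⟨i, h.apply_E_eq hα hi, hi⟩

/-- The eigenspaces of `E` in an `𝔞`-invariant subspace are spanned by joint eigenvectors. -/
lemma eigenspace_eq_iSup [FiniteDimensional ℝ L] (W : Submodule ℝ L)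
    (hW : ∀ H ∈ 𝔞, ∀ X ∈ W, ⁅H, X⁆ ∈ W) {c : ℝ} :
    ∀ X ∈ W, ⁅E, X⁆ = c • X →
      X ∈ ⨆ α : Dual ℝ 𝔞, ⨆ _ : α ⟨E, h.E_mem⟩ = c, W ⊓ rootSpace 𝔞 α := by
  let W' : Submodule ℝ L :=
    W ⊓ LinearMap.ker (LieAlgebra.ad ℝ L E - c • LinearMap.id : L →ₗ[ℝ] L)
  have hmem : ∀ X, X ∈ W' ↔ X ∈ W ∧ ⁅E, X⁆ = c • X := fun X => by
    simp [W', sub_eq_zero]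
  intro X hX hEX
  have hX' := (hmem X).2 ⟨hX, hEX⟩
  rw [h.cartan.eq_iSup_inf_rootSpace h.maximal.le_q h.maximal.abelian W' fun H hH X hX => by
    obtain ⟨h1, h2⟩ := (hmem X).1 hX
    refine (hmem _).2 ⟨hW H hH X h1, ?_⟩
    rw [leibniz_lie, lie_eq_zero_symm (h.commute_E hH), zero_lie, zero_add, h2, lie_smul]] at hX'
  refine (iSup_le fun α => ?_ : (⨆ α, W' ⊓ rootSpace 𝔞 α) ≤ _) hX'
  rintro Z ⟨hZ, hZα⟩
  by_cases hZ0 : Z = 0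
  · rw [hZ0]; exact Submodule.zero_mem _
  have hc : α ⟨E, h.E_mem⟩ = c :=
    smul_left_injective ℝ hZ0 ((h.lie_E hZα).symm.trans ((hmem Z).1 hZ).2)
  exact Submodule.mem_iSup_of_mem α (Submodule.mem_iSup_of_mem hc ⟨((hmem Z).1 hZ).1, hZα⟩)

/-- Describing `𝔤_i` as the full `i`-eigenspace of `ad E` makes it accessible to `θ` and to
automorphisms fixing `E`, without reference to roots. -/
lemma mem_gradingPiece_iff [FiniteDimensional ℝ L] :
    X ∈ gradingPiece Φ 𝔭 i ↔ ⁅E, X⁆ = (i : ℝ) • X := by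
  refine ⟨h.grading.lie_eq i X, fun hX => ?_⟩
  refine (iSup₂_le fun α hα => ?_ : (⨆ α : Dual ℝ 𝔞, ⨆ _ : α ⟨E, h.E_mem⟩ = (i : ℝ),
    (⊤ : Submodule ℝ L) ⊓ rootSpace 𝔞 α) ≤ gradingPiece Φ 𝔭 i)
    (h.eigenspace_eq_iSup ⊤ (by simp) X trivial hX)
  rw [top_inf_eq]
  by_cases hbot : rootSpace 𝔞 α = ⊥
  · rw [hbot]; exact bot_le
  obtain ⟨j, hj, hle⟩ := h.exists_int_apply_E hbot
  rw [hj, Int.cast_inj] at hα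
  exact hα ▸ hle

lemma rootSpace_zero_le [FiniteDimensional ℝ L] : rootSpace 𝔞 0 ≤ 𝔭.toSubmodule :=
  (rootSpace_zero_le_sup h.cartan h.maximal).trans (le_sup_left.trans h.pZero_le)

lemma le_parabolic [FiniteDimensional ℝ L] : 𝔞 ≤ 𝔭.toSubmodule :=
  (le_sup_right.trans le_sup_left).trans h.pZero_le

lemma rootSpace_le (hα : α ∈ Φ) : rootSpace 𝔞 α ≤ 𝔭.toSubmodule :=
  (le_iSup₂_of_le (f := fun α (_ : α ∈ Φ) => rootSpace 𝔞 α) α hα le_rfl).trans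
    (le_sup_right.trans h.pZero_le)

lemma simple_apply_E [FiniteDimensional ℝ L] (hα : α ∈ simpleRoots Φ) :
    (α ∈ crossedRoots Φ 𝔭 ∧ α ⟨E, h.E_mem⟩ = 1) ∨
      (α ∉ crossedRoots Φ 𝔭 ∧ α ⟨E, h.E_mem⟩ = 0) := by
  classical
  have hle := rootSpace_le_gradingPiece (𝔭 := 𝔭) (Φ := Φ) (Finsupp.single α 1) fun β hβ => by
    rwa [Finset.mem_singleton.1 (Finsupp.support_single_subset hβ)]
  rw [Finsupp.sum_single_index (by simp), one_smul] at hle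
  have := h.apply_E_eq (h.positive.mem_restrictedRoots hα.1).2 hle
  rw [sigmaHeight, Finsupp.sum_single_index (by simp)] at this
  by_cases hc : α ∈ crossedRoots Φ 𝔭
  · exact Or.inl ⟨hc, by simpa [hc] using this⟩
  · exact Or.inr ⟨hc, by simpa [hc] using this⟩

lemma apply_E_nonneg [FiniteDimensional ℝ L] : ∀ α ∈ Φ, 0 ≤ α ⟨E, h.E_mem⟩ := by
  refine h.positive.simple_induction h.maximal (fun α hα => ?_) fun α _ β _ hα hβ => ?_
  · rcases h.simple_apply_E hα with h' | h' <;> simp [h'.2]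
  · rw [LinearMap.add_apply]; exact add_nonneg hα hβ

/-- An uncrossed simple root satisfies this by definition. For other roots, `α(E) = 0` splits into
nonnegative values on positive summands, so both vanish, and brackets of the smaller negative root
spaces generate. -/
lemma rootSpace_neg_le [FiniteDimensional ℝ L] :
    ∀ α ∈ Φ, α ⟨E, h.E_mem⟩ = 0 → rootSpace 𝔞 (-α) ≤ 𝔭.toSubmodule := by
  refine h.positive.induction h.maximal fun α hα ih hαE => ?_
  by_cases hs : α ∈ simpleRoots Φ
  · rcases h.simple_apply_E hs with h' | h'
    · simp [h'.2] at hαE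
    · by_contra hcon
      exact h'.1 ⟨hs, hcon⟩
  refine h.positive.rootSpace_neg_le h.cartan h.maximal hα hs fun β hβ hαβ U hU V hV => ?_
  have h1 := h.apply_E_nonneg β hβ.1
  have h2 := h.apply_E_nonneg _ hαβ
  have h3 : α ⟨E, h.E_mem⟩ = β ⟨E, h.E_mem⟩ + (α - β) ⟨E, h.E_mem⟩ := by simp
  refine 𝔭.lie_mem (ih β hβ.1 hαβ (by linarith) hU) (ih _ hαβ ?_ (by linarith) hV)
  simpa using hβ.1

/-- For a crossed simple root, a single nonzero vector of `𝔭` in the root space of `-α` would put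
that whole space into `𝔭`, via `(ad X)²`. Other roots are lowered by a simple root. -/
lemma eq_zero_of_mem_neg [FiniteDimensional ℝ L] :
    ∀ α ∈ Φ, 0 < α ⟨E, h.E_mem⟩ → ∀ X ∈ 𝔭, X ∈ rootSpace 𝔞 (-α) → X = 0 := by
  refine h.positive.induction h.maximal fun α hα ih hαE X hX hXα => ?_
  by_contra hX0
  by_cases hs : α ∈ simpleRoots Φ
  · rcases h.simple_apply_E hs with h' | h'
    · refine h'.1.2 fun Y hY => ?_
      obtain ⟨W, hW, rfl⟩ := rootSpace_neg_le_of_mem h.cartan h.maximal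
        (h.positive.mem_restrictedRoots hα).1 hXα hX0 hY
      exact 𝔭.lie_mem hX (𝔭.lie_mem hX (h.rootSpace_le hα hW))
    · exact hαE.ne' h'.2
  obtain ⟨β, hβ, hαβ, U, hU, hUX⟩ :=
    h.positive.exists_lie_ne_zero h.cartan h.maximal hα hs hXα hX0
  have hUXmem := lie_mem_rootSpace hU hXα
  rw [show β + -α = -(α - β) by abel] at hUXmem
  have hαβE := h.apply_E_nonneg _ hαβ
  rcases hαβE.lt_or_eq with hlt | heq
  · exact hUX (ih _ hαβ (by simpa using hβ.1) hlt _
      (𝔭.lie_mem (h.rootSpace_le hβ.1 hU) hX) hUXmem)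
  -- Here `α - β` has height `0`, so the induction hypothesis for `α - β` does not apply. Since
  -- `β(E) = α(E) > 0`, it applies to `β` instead, and to the vector `[θ [U, X], X]` of `𝔭`, whose
  -- vanishing forces `|[U, X]|² = 0`.
  · have hV := theta_mem_rootSpace h.maximal.le_q hUXmem
    rw [neg_neg] at hV
    have hVX := lie_mem_rootSpace hV hXα
    rw [show α - β + -α = -β by abel] at hVX
    have h3 : α ⟨E, h.E_mem⟩ = β ⟨E, h.E_mem⟩ + (α - β) ⟨E, h.E_mem⟩ := by simp
    have h0 := ih β hβ.1 hαβ (by linarith) _ (𝔭.lie_mem (h.rootSpace_le hαβ hV) hX) hVX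
    refine hUX (h.cartan.eq_zero_of_killing ?_)
    rw [killing_comm, ← lie_skew U X, map_neg, ← killing_lie_left, lie_skew, h0]
    simp

end IsGradedParabolic

end Parabolic

/-! ### The parabolic as a sum of eigenspaces of the grading element -/

section ParabolicConsequences

variable {L : Type*} [LieRing L] [LieAlgebra ℝ L] [FiniteDimensional ℝ L]

namespace IsGradedParabolic

variable {θ : L ≃ₗ⁅ℝ⁆ L} {𝔞 : Submodule ℝ L} {Φ : Set (Dual ℝ 𝔞)} {𝔭 : LieSubalgebra ℝ L} {E : L}
  (h : IsGradedParabolic θ 𝔞 Φ 𝔭 E) {α β : Dual ℝ 𝔞} {X Y : L} {i : ℤ}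

include h

lemma apply_E_nonneg_of_mem (hX : X ∈ 𝔭) (hXα : X ∈ rootSpace 𝔞 α) (hX0 : X ≠ 0) :
    0 ≤ α ⟨E, h.E_mem⟩ := by
  by_contra! hlt
  have hbot : rootSpace 𝔞 α ≠ ⊥ := (Submodule.ne_bot_iff _).2 ⟨X, hXα, hX0⟩
  have h0 : α ≠ 0 := by rintro rfl; simp at hlt
  rcases h.positive.mem_or_neg_mem h.maximal ⟨h0, hbot⟩ with h' | h'
  · exact hlt.not_ge (h.apply_E_nonneg α h')
  · exact hX0 (h.eq_zero_of_mem_neg (-α) h' (by simpa using hlt) X hX (by simpa using hXα))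

lemma rootSpace_le_of_nonneg (hα : 0 ≤ α ⟨E, h.E_mem⟩) : rootSpace 𝔞 α ≤ 𝔭.toSubmodule := by
  by_cases hbot : rootSpace 𝔞 α = ⊥
  · rw [hbot]; exact bot_le
  by_cases h0 : α = 0
  · rw [h0]; exact h.rootSpace_zero_le
  rcases h.positive.mem_or_neg_mem h.maximal ⟨h0, hbot⟩ with h' | h'
  · exact h.rootSpace_le h'
  · have h1 := h.apply_E_nonneg _ h'
    rw [LinearMap.neg_apply] at h1
    simpa using h.rootSpace_neg_le (-α) h' (by rw [LinearMap.neg_apply]; linarith)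

lemma induction_parabolic {p : L → Prop}
    (hroot : ∀ α, 0 ≤ α ⟨E, h.E_mem⟩ → ∀ X ∈ rootSpace 𝔞 α, p X)
    (hadd : ∀ X Y, p X → p Y → p (X + Y)) (hX : X ∈ 𝔭) : p X := by
  have h0 : p 0 := hroot 0 (by simp) 0 (Submodule.zero_mem _)
  have hX' : X ∈ 𝔭.toSubmodule := hX
  rw [h.cartan.eq_iSup_inf_rootSpace h.maximal.le_q h.maximal.abelian 𝔭.toSubmodule
    fun H hH X hX => 𝔭.lie_mem (h.le_parabolic hH) hX] at hX'
  refine Submodule.iSup_induction _ (motive := p) hX' (fun α Z hZ => ?_) h0 hadd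
  by_cases hZ0 : Z = 0
  · exact hZ0 ▸ h0
  · exact hroot α (h.apply_E_nonneg_of_mem hZ.1 hZ.2 hZ0) Z hZ.2

/-- `B` pairs eigenvalues `a` and `b` of `ad E` nontrivially only if `a + b = 0`. On `𝔭` both are
nonnegative, so only `a = b = 0` survives, and there `[E, X] = 0`. -/
lemma killing_lie_E (hX : X ∈ 𝔭) (hY : Y ∈ 𝔭) : killingForm ℝ L ⁅E, X⁆ Y = 0 := by
  refine h.induction_parabolic (p := fun X => killingForm ℝ L ⁅E, X⁆ Y = 0)
    (fun α hα X hX => ?_) (fun X X' hX hX' => by simp [hX, hX']) hX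
  refine h.induction_parabolic (p := fun Y => killingForm ℝ L ⁅E, X⁆ Y = 0)
    (fun β hβ Y hY => ?_) (fun X X' hX hX' => by simp [hX, hX']) hY
  have h1 := killing_rootSpace ⟨E, h.E_mem⟩ hX hY
  rw [h.lie_E hX, map_smul, LinearMap.smul_apply, smul_eq_mul]
  rcases mul_eq_zero.1 h1 with h2 | h2
  · rw [show α ⟨E, h.E_mem⟩ = 0 by linarith, zero_mul]
  · rw [h2, mul_zero]

/-- The intersection of the parabolic and its opposite is the centralizer of `E`. -/
lemma lie_E_eq_zero_iff : ⁅E, X⁆ = 0 ↔ X ∈ 𝔭 ∧ θ X ∈ 𝔭 := by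
  constructor
  · have key : ∀ X : L, ⁅E, X⁆ = 0 → X ∈ 𝔭 := fun X hX => by
      have h1 := h.eigenspace_eq_iSup ⊤ (by simp) (c := 0) X trivial (by simpa using hX)
      refine (iSup₂_le fun α hα => ?_ : (⨆ α : Dual ℝ 𝔞, ⨆ _ : α ⟨E, h.E_mem⟩ = 0,
        (⊤ : Submodule ℝ L) ⊓ rootSpace 𝔞 α) ≤ 𝔭.toSubmodule) h1
      exact inf_le_right.trans (h.rootSpace_le_of_nonneg hα.ge)
    intro hX
    refine ⟨key X hX, key _ ?_⟩
    have := congrArg θ hX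
    rwa [LieEquiv.map_lie, h.theta_E, neg_lie, map_zero, neg_eq_zero] at this
  · rintro ⟨hX, hθX⟩
    -- Up to sign, the squared norm of `[E, X]` is `B([E, X], [E, θ X])`, where `X` and `[E, θ X]`
    -- both lie in `𝔭`.
    refine h.cartan.eq_zero_of_killing ?_
    rw [LieEquiv.map_lie, h.theta_E, neg_lie, map_neg,
      h.killing_lie_E hX (𝔭.lie_mem (h.le_parabolic h.E_mem) hθX), neg_zero]

lemma theta_mem_gradingPiece (hX : X ∈ gradingPiece Φ 𝔭 i) : θ X ∈ gradingPiece Φ 𝔭 (-i) := by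
  rw [h.mem_gradingPiece_iff] at hX ⊢
  have := congrArg θ hX
  rw [LieEquiv.map_lie, h.theta_E, neg_lie, map_smul] at this
  rw [Int.cast_neg, neg_smul, ← this, neg_neg]

omit [FiniteDimensional ℝ L] in
lemma killing_E_gradingPiece (hi : i ≠ 0) (hX : X ∈ gradingPiece Φ 𝔭 i) :
    killingForm ℝ L E X = 0 := by
  have h1 := killing_lie_left E E X
  rw [lie_self, map_zero, LinearMap.zero_apply, h.grading.lie_eq i X hX, map_smul, smul_eq_mul,
    zero_eq_mul] at h1
  exact h1.resolve_left (by exact_mod_cast hi)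

lemma gradingPiece_le (hi : 0 ≤ i) : gradingPiece Φ 𝔭 i ≤ 𝔭.toSubmodule := fun X hX => by
  have h1 := h.eigenspace_eq_iSup ⊤ (by simp) X trivial (h.mem_gradingPiece_iff.1 hX)
  refine (iSup₂_le fun α hα => ?_ : (⨆ α : Dual ℝ 𝔞, ⨆ _ : α ⟨E, h.E_mem⟩ = (i : ℝ),
    (⊤ : Submodule ℝ L) ⊓ rootSpace 𝔞 α) ≤ 𝔭.toSubmodule) h1
  exact inf_le_right.trans (h.rootSpace_le_of_nonneg (hα ▸ by exact_mod_cast hi))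

lemma induction_gradingPiece {p : L → Prop} (hp : ∀ i, ∀ X ∈ gradingPiece Φ 𝔭 i, p X)
    (hadd : ∀ X Y, p X → p Y → p (X + Y)) (X : L) : p X := by
  refine h.induction_rootSpace (fun α X hX => ?_) hadd X
  by_cases hX0 : X = 0
  · exact hp 0 X (hX0 ▸ Submodule.zero_mem _)
  · obtain ⟨i, -, hi⟩ := h.exists_int_apply_E ((Submodule.ne_bot_iff _).2 ⟨X, hX, hX0⟩)
    exact hp i X (hi hX)

/-- The Iwasawa-type decomposition `𝔤 = 𝔭 + 𝔨`. -/
lemma exists_add_eq (X : L) : ∃ Y ∈ 𝔭, ∃ Z ∈ kPart θ, Y + Z = X := by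
  refine h.induction_gradingPiece (p := fun X => ∃ Y ∈ 𝔭, ∃ Z ∈ kPart θ, Y + Z = X)
    (fun i X hX => ?_) ?_ X
  · rcases le_total 0 i with hi | hi
    · exact ⟨X, h.gradingPiece_le hi hX, 0, Submodule.zero_mem _, add_zero X⟩
    -- A vector of nonpositive degree is corrected by its reflection: `X = -θ X + (X + θ X)`.
    · exact ⟨-θ X, 𝔭.neg_mem (h.gradingPiece_le (by omega) (h.theta_mem_gradingPiece hX)),
        X + θ X, h.cartan.theta_add_mem_kPart X, by abel⟩
  · rintro _ _ ⟨Y, hY, Z, hZ, rfl⟩ ⟨Y', hY', Z', hZ', rfl⟩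
    exact ⟨Y + Y', 𝔭.add_mem hY hY', Z + Z', Submodule.add_mem _ hZ hZ', by abel⟩

/-- If `E` were zero, its centralizer `𝔭 ∩ θ 𝔭` would be all of `𝔤`, against properness of `𝔭`. -/
lemma killing_E_pos (hne : 𝔭 ≠ ⊤) : 0 < killingForm ℝ L E E := by
  have hE0 : E ≠ 0 := by
    intro hE0
    refine hne (eq_top_iff.2 fun X _ => (h.lie_E_eq_zero_iff.1 ?_).1)
    rw [hE0, zero_lie]
  simpa [h.theta_E] using h.cartan.posDef E hE0

/-! ### Automorphisms preserving `𝔨` and `𝔭` -/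

section Automorphism

variable {φ : L ≃ₗ⁅ℝ⁆ L}

-- An automorphism is an isometry of `B`, so preserving `𝔨` it also preserves the orthogonal
-- complement `𝔮`, and `θ` is determined by these two eigenspaces.
omit h [FiniteDimensional ℝ L] in
lemma _root_.PoissonTransform.IsCartanInvolution.commute_automorphism (hθ : IsCartanInvolution θ)
    (hk : ∀ X ∈ kPart θ, φ X ∈ kPart θ) (hk' : ∀ X ∈ kPart θ, φ.symm X ∈ kPart θ) (X : L) :
    θ (φ X) = φ (θ X) := by
  have hq : ∀ X ∈ qPart θ, φ X ∈ qPart θ := by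
    intro X hX
    have h0 : φ X + θ (φ X) = 0 := by
      have hmem := hθ.theta_add_mem_kPart (φ X)
      refine hθ.eq_zero_of_killing ?_
      rw [mem_kPart.1 hmem, map_add, hθ.killing_theta_right, mem_kPart.1 hmem]
      have h1 := LieAlgebra.killingForm_of_equiv_apply φ.symm (φ X + θ (φ X)) (φ X)
      rw [φ.symm_apply_apply, killing_eq_zero_of_mem (hk' _ hmem) hX] at h1
      rw [← h1, add_zero]
    exact mem_qPart.2 (eq_neg_of_add_eq_zero_right h0)
  have h1 := mem_kPart.1 (hk _ (hθ.theta_add_mem_kPart X))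
  have h2 := mem_qPart.1 (hq _ (hθ.sub_theta_mem_qPart X))
  simp only [map_add, map_sub] at h1 h2
  have h3 : (2 : ℝ) • θ (φ X) = (2 : ℝ) • φ (θ X) := by
    rw [two_smul, two_smul]
    calc θ (φ X) + θ (φ X)
        = (θ (φ X) + θ (φ (θ X))) + (θ (φ X) - θ (φ (θ X))) := by abel
      _ = _ := by rw [h1, h2]; abel
  exact smul_right_injective L (two_ne_zero (α := ℝ)) h3

/-- Automorphisms preserving `𝔨` and `𝔭` fix the grading element. -/
theorem automorphism_E (hk : ∀ X ∈ kPart θ, φ X ∈ kPart θ)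
    (hk' : ∀ X ∈ kPart θ, φ.symm X ∈ kPart θ) (hp : ∀ X ∈ 𝔭, φ X ∈ 𝔭)
    (hp' : ∀ X ∈ 𝔭, φ.symm X ∈ 𝔭) : φ E = E := by
  have hcomm := h.cartan.commute_automorphism hk hk'
  have hcomm' := h.cartan.commute_automorphism (φ := φ.symm) hk' hk
  have hq : φ E ∈ qPart θ := by rw [mem_qPart, hcomm, h.theta_E, map_neg]
  -- `φ` preserves `𝔭 ∩ θ 𝔭`, the centralizer of `E`; hence `φ E` is central there too, which places
  -- it in `𝔞`.
  have hcent : ∀ X : L, ⁅E, X⁆ = 0 → ⁅φ E, X⁆ = 0 := by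
    intro X hX
    obtain ⟨h1, h2⟩ := h.lie_E_eq_zero_iff.1 hX
    have h3 : ⁅E, φ.symm X⁆ = 0 :=
      h.lie_E_eq_zero_iff.2 ⟨hp' _ h1, by rw [hcomm']; exact hp' _ h2⟩
    have h4 := congrArg φ h3
    rwa [LieEquiv.map_lie, φ.apply_symm_apply, map_zero] at h4
  have hmem : φ E ∈ 𝔞 := h.maximal.mem_of_commute hq fun H => by
    simpa using lie_eq_zero_symm (hcent H (lie_eq_zero_symm (h.commute_E H.2)))
  have hpos : ∀ α ∈ Φ, α ⟨E, h.E_mem⟩ ≤ α ⟨φ E, hmem⟩ := by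
    refine h.positive.simple_induction h.maximal (fun α hα => ?_) fun α _ β _ hα hβ => ?_
    · obtain ⟨X, hX, hX0⟩ := Submodule.exists_mem_ne_zero_of_ne_bot
        (h.positive.mem_restrictedRoots hα.1).2
      have hφE : ⁅φ E, X⁆ = α ⟨φ E, hmem⟩ • X := hX ⟨φ E, hmem⟩
      rcases h.simple_apply_E hα with ⟨-, h1⟩ | ⟨-, h1⟩
      -- The eigenvalue of `φ E` at `X` is that of `E` at `φ⁻¹ X`, which lies in `𝔭`; so it is a
      -- nonnegative integer. It is not `0`, since then `φ⁻¹ X`, and hence `X`, would commute with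
      -- `E`, although `α(E) = 1`.
      · have hEY : ⁅E, φ.symm X⁆ = α ⟨φ E, hmem⟩ • φ.symm X := by
          have := congrArg φ.symm hφE
          rwa [LieEquiv.map_lie, φ.symm_apply_apply, map_smul] at this
        have hY := hp' X (h.rootSpace_le hα.1 hX)
        have hY0 : φ.symm X ≠ 0 := fun h0 => hX0 (theta_eq_zero_iff.1 h0)
        have hsup := h.eigenspace_eq_iSup 𝔭.toSubmodule
          (fun H hH X hX => 𝔭.lie_mem (h.le_parabolic hH) hX) _ hY hEY
        have hex : ∃ β : Dual ℝ 𝔞, β ⟨E, h.E_mem⟩ = α ⟨φ E, hmem⟩ ∧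
            ∃ Z ∈ 𝔭, Z ∈ rootSpace 𝔞 β ∧ Z ≠ 0 := by
          by_contra! hcon
          have hbot : (⨆ β : Dual ℝ 𝔞, ⨆ _ : β ⟨E, h.E_mem⟩ = α ⟨φ E, hmem⟩,
              𝔭.toSubmodule ⊓ rootSpace 𝔞 β) ≤ ⊥ :=
            iSup₂_le fun β hβ Z hZ => hcon β hβ Z hZ.1 hZ.2
          exact hY0 (hbot hsup)
        obtain ⟨β, hβ, Z, hZ, hZβ, hZ0⟩ := hex
        have hnonneg := h.apply_E_nonneg_of_mem hZ hZβ hZ0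
        obtain ⟨j, hj, -⟩ := h.exists_int_apply_E ((Submodule.ne_bot_iff _).2 ⟨Z, hZβ, hZ0⟩)
        have hj0 : j ≠ 0 := by
          rintro rfl
          rw [← hβ, hj, Int.cast_zero, zero_smul, h.lie_E_eq_zero_iff, hcomm'] at hEY
          have h5 : ⁅E, X⁆ = 0 := by
            refine h.lie_E_eq_zero_iff.2 ⟨?_, ?_⟩
            · simpa using hp _ hEY.1
            · simpa using hp _ hEY.2
          rw [h.lie_E hX, h1, one_smul] at h5
          exact hX0 h5
        rw [hj] at hnonneg
        rw [h1, ← hβ, hj]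
        have : 0 ≤ j := by exact_mod_cast hnonneg
        exact_mod_cast (by omega : 1 ≤ j)
      · have h2 := hcent X (by rw [h.lie_E hX, h1, zero_smul])
        rw [hφE] at h2
        rw [h1, (smul_eq_zero.1 h2).resolve_right hX0]
    · rw [LinearMap.add_apply, LinearMap.add_apply]
      exact add_le_add hα hβ
  set H : 𝔞 := ⟨E, h.E_mem⟩ with hH
  set H' : 𝔞 := ⟨φ E, hmem⟩ with hH'
  -- By the trace formula for `B` on `𝔞` it suffices that `(α(φ E) - α(E)) α(E) ≥ 0` for each root;
  -- for negative roots both factors change sign.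
  have htr : 0 ≤ killingForm ℝ L ((H' - H : 𝔞) : L) (H : L) := by
    refine killing_nonneg_of_forall h.cartan h.maximal.le_q h.maximal.abelian _ _ fun α hα => ?_
    rw [map_sub]
    by_cases h0 : α = 0
    · simp [h0]
    rcases h.positive.mem_or_neg_mem h.maximal ⟨h0, hα⟩ with h' | h'
    · exact mul_nonneg (sub_nonneg.2 (hpos α h')) (h.apply_E_nonneg α h')
    · have h1 := hpos _ h'
      have h2 := h.apply_E_nonneg _ h'
      simp only [LinearMap.neg_apply] at h1 h2
      exact mul_nonneg_of_nonpos_of_nonpos (by linarith) (by linarith)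
  have hiso := LieAlgebra.killingForm_of_equiv_apply φ E E
  -- As `φ` preserves `B`, `|φ E - E|² = 2 B(E, E) - 2 B(φ E, E)`, which is nonpositive by the
  -- previous inequality.
  have hD : φ E - E = 0 := by
    refine h.cartan.eq_zero_of_nonpos ?_
    rw [Submodule.coe_sub] at htr
    rw [map_sub θ, hcomm, h.theta_E, map_neg]
    simp only [hH, hH', map_sub, map_neg, LinearMap.sub_apply] at htr ⊢
    have := killing_comm (φ E) E
    linarith
  exact sub_eq_zero.1 hD

end Automorphism

end IsGradedParabolic

end ParabolicConsequences

/-! ### Alternating `2`-forms, bidegrees and quotients -/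

section AlternatingTwo

variable {V : Type*} [AddCommGroup V] [Module ℝ V] (w : V [⋀^Fin 2]→ₗ[ℝ] ℝ)

lemma alternating_swap (a b : V) : w ![b, a] = -w ![a, b] := by
  have h := w.map_swap ![a, b] (show (0 : Fin 2) ≠ 1 by decide)
  rw [← h]
  congr 1
  ext i
  fin_cases i <;> rfl

lemma alternating_add_left (a a' b : V) : w ![a + a', b] = w ![a, b] + w ![a', b] := by
  have h := congrArg (fun f => f ![b]) (w.curryLeft.map_add a a')
  exact h

lemma alternating_add_right (a b b' : V) : w ![a, b + b'] = w ![a, b] + w ![a, b'] := by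
  rw [alternating_swap w (b + b') a, alternating_add_left, alternating_swap w a b,
    alternating_swap w a b']
  ring

lemma eq_vec_two {A : Type*} (v : Fin 2 → A) : v = ![v 0, v 1] := by
  ext i
  fin_cases i <;> rfl

/-- A `2`-form of degree `(2, 0)` vanishing on pairs of vectors of `V₁₀` is zero. -/
lemma HasBidegree.eq_zero {V₁₀ V₀₁ : Submodule ℝ V} {w : V [⋀^Fin 2]→ₗ[ℝ] ℝ}
    (hw : HasBidegree V₁₀ V₀₁ 2 0 w) (htop : V₁₀ ⊔ V₀₁ = ⊤)
    (h0 : ∀ a ∈ V₁₀, ∀ b ∈ V₁₀, w ![a, b] = 0) : w = 0 := by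
  have hright : ∀ a, ∀ b ∈ V₀₁, w ![a, b] = 0 := fun a b hb =>
    hw.2 _ {1} (Or.inr ⟨by simp, by simpa using hb⟩)
  have hleft : ∀ a ∈ V₀₁, ∀ b, w ![a, b] = 0 := fun a ha b => by
    rw [alternating_swap, hright b a ha, neg_zero]
  refine AlternatingMap.ext fun v => ?_
  rw [eq_vec_two v]
  obtain ⟨a, ha, a', ha', hv0⟩ := Submodule.mem_sup.1 (htop ▸ Submodule.mem_top : v 0 ∈ V₁₀ ⊔ V₀₁)
  obtain ⟨b, hb, b', hb', hv1⟩ := Submodule.mem_sup.1 (htop ▸ Submodule.mem_top : v 1 ∈ V₁₀ ⊔ V₀₁)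
  rw [← hv0, ← hv1, alternating_add_left, alternating_add_right, h0 a ha b hb, hright a b' hb',
    hleft a' ha']
  simp

lemma hasBidegree_one_one {V₁₀ V₀₁ : Submodule ℝ V} {w : V [⋀^Fin 2]→ₗ[ℝ] ℝ}
    (h₁₀ : ∀ a ∈ V₁₀, ∀ b ∈ V₁₀, w ![a, b] = 0) (h₀₁ : ∀ a ∈ V₀₁, ∀ b ∈ V₀₁, w ![a, b] = 0) :
    HasBidegree V₁₀ V₀₁ 1 1 w := by
  refine ⟨rfl, fun v s hs => ?_⟩
  have huniv : 1 < s.card → s = Finset.univ := fun h =>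
    Finset.eq_univ_of_card s (le_antisymm s.card_le_univ (by rw [Fintype.card_fin]; exact h))
  rw [eq_vec_two v]
  rcases hs with ⟨hc, hs⟩ | ⟨hc, hs⟩
  · exact h₁₀ _ (hs 0 (by simp [huniv hc])) _ (hs 1 (by simp [huniv hc]))
  · exact h₀₁ _ (hs 0 (by simp [huniv hc])) _ (hs 1 (by simp [huniv hc]))

lemma hasBidegree_zero (V₁₀ V₀₁ : Submodule ℝ V) {p q n : ℕ} (hn : n = p + q) :
    HasBidegree V₁₀ V₀₁ p q (0 : V [⋀^Fin n]→ₗ[ℝ] ℝ) :=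
  ⟨hn, fun _ _ _ => rfl⟩

/-- An alternating bilinear form whose radical contains `𝔪` descends to the quotient by `𝔪`. -/
lemma exists_alternating_quotient (𝔪 : Submodule ℝ V) (β : V →ₗ[ℝ] V →ₗ[ℝ] ℝ)
    (halt : ∀ X, β X X = 0) (h𝔪 : ∀ X ∈ 𝔪, ∀ Y, β X Y = 0) :
    ∃ η : (V ⧸ 𝔪) [⋀^Fin 2]→ₗ[ℝ] ℝ, ∀ X Y, η ![𝔪.mkQ X, 𝔪.mkQ Y] = β X Y := by
  have hskew : ∀ X Y, β X Y = -β Y X := fun X Y => by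
    have h := halt (X + Y)
    simp only [map_add, LinearMap.add_apply, halt] at h
    linarith
  let b₁ : (V ⧸ 𝔪) →ₗ[ℝ] V →ₗ[ℝ] ℝ := 𝔪.liftQ β fun X hX => LinearMap.ext fun Y => h𝔪 X hX Y
  let b : (V ⧸ 𝔪) →ₗ[ℝ] (V ⧸ 𝔪) →ₗ[ℝ] ℝ := 𝔪.liftQ b₁.flip fun Y hY => by
    refine LinearMap.ext fun x => ?_
    obtain ⟨X, rfl⟩ := 𝔪.mkQ_surjective x
    change β X Y = 0
    rw [hskew, h𝔪 Y hY, neg_zero]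
  -- Lifting the flipped form exchanges the arguments, which is why the alternating map below is `b
  -- (v 1) (v 0)`.
  have hb : ∀ X Y, b (𝔪.mkQ Y) (𝔪.mkQ X) = β X Y := fun X Y => rfl
  refine ⟨{ toFun := fun v => b (v 1) (v 0)
            map_update_add' := ?_
            map_update_smul' := ?_
            map_eq_zero_of_eq' := ?_ }, fun X Y => hb X Y⟩
  · intro _ v i x y
    fin_cases i <;> simp [Function.update]
  · intro _ v i c x
    fin_cases i <;> simp [Function.update]
  · intro v i j hij hne
    have h01 : v 0 = v 1 := by
      fin_cases i <;> fin_cases j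
      exacts [absurd rfl hne, hij, hij.symm, absurd rfl hne]
    obtain ⟨X, hX⟩ := 𝔪.mkQ_surjective (v 1)
    change b (v 1) (v 0) = 0
    rw [h01, ← hX, hb, halt]

end AlternatingTwo

/-! ### The covector `E^*` and its derivative on `𝔤/𝔪` -/

section Quotient

variable {L : Type*} [LieRing L] [LieAlgebra ℝ L] [FiniteDimensional ℝ L]

namespace IsGradedParabolic

variable {θ : L ≃ₗ⁅ℝ⁆ L} {𝔞 : Submodule ℝ L} {Φ : Set (Dual ℝ 𝔞)} {𝔭 : LieSubalgebra ℝ L} {E : L}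
  (h : IsGradedParabolic θ 𝔞 Φ 𝔭 E) {𝔪 : Submodule ℝ L}
  (hm : ∀ X, X ∈ 𝔪 ↔ X ∈ kPart θ ∧ X ∈ 𝔭) (hne : 𝔭 ≠ ⊤)

include h

lemma killing_E_kPart {X : L} (hX : X ∈ kPart θ) : killingForm ℝ L E X = 0 := by
  rw [killing_comm]
  exact killing_eq_zero_of_mem hX h.E_mem_qPart

include hm

lemma lie_E_of_mem {X : L} (hX : X ∈ 𝔪) : ⁅E, X⁆ = 0 := by
  obtain ⟨h1, h2⟩ := (hm X).1 hX
  exact h.lie_E_eq_zero_iff.2 ⟨h2, by rwa [mem_kPart.1 h1]⟩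

/-- The functional descends to the quotient because `𝔪` is contained in `𝔨`, which is orthogonal to
`E`. -/
lemma exists_covector : ∃ ε : Dual ℝ (L ⧸ 𝔪), ∀ X,
    ε (𝔪.mkQ X) = (killingForm ℝ L E E)⁻¹ * killingForm ℝ L E X :=
  ⟨𝔪.liftQ ((killingForm ℝ L E E)⁻¹ • killingForm ℝ L E) fun X hX => by
    simp [h.killing_E_kPart ((hm X).1 hX).1], fun X => by simp⟩

/-- Written as `B([E, X], Y)`, the form visibly has `𝔪` in its radical, since `𝔪` centralizes `E`.
-/
lemma exists_form : ∃ η : (L ⧸ 𝔪) [⋀^Fin 2]→ₗ[ℝ] ℝ, ∀ X Y,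
    η ![𝔪.mkQ X, 𝔪.mkQ Y] =
      -((killingForm ℝ L E E)⁻¹ * killingForm ℝ L E ⁅X, Y⁆) := by
  have hβ : ∀ X Y, (-(killingForm ℝ L E E)⁻¹ • (killingForm ℝ L ∘ₗ LieAlgebra.ad ℝ L E)) X Y =
      -((killingForm ℝ L E E)⁻¹ * killingForm ℝ L E ⁅X, Y⁆) := fun X Y => by
    simp [killing_lie_left]
  obtain ⟨η, hη⟩ := exists_alternating_quotient 𝔪
    (-(killingForm ℝ L E E)⁻¹ • (killingForm ℝ L ∘ₗ LieAlgebra.ad ℝ L E))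
    (fun X => by rw [hβ, lie_self]; simp)
    (fun X hX Y => by simp [h.lie_E_of_mem hm hX])
  exact ⟨η, fun X Y => (hη X Y).trans (hβ X Y)⟩

omit hm in
lemma quot_sup_eq_top : quotOneZero 𝔪 𝔭 ⊔ quotZeroOne 𝔪 θ = ⊤ := by
  refine eq_top_iff.2 fun x _ => ?_
  obtain ⟨X, rfl⟩ := 𝔪.mkQ_surjective x
  obtain ⟨Y, hY, Z, hZ, rfl⟩ := h.exists_add_eq X
  rw [map_add]
  exact Submodule.add_mem_sup ⟨Y, hY, rfl⟩ ⟨Z, hZ, rfl⟩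

include hne

omit hm in
lemma isDualCovector {ε : Dual ℝ (L ⧸ 𝔪)}
    (hε : ∀ X, ε (𝔪.mkQ X) = (killingForm ℝ L E E)⁻¹ * killingForm ℝ L E X) :
    IsDualCovector θ Φ 𝔭 𝔪 E ε where
  apply_self := by rw [hε, inv_mul_cancel₀ (h.killing_E_pos hne).ne']
  apply_orthogonal X _ hX := by rw [hε, hX, mul_zero]
  apply_piece i hi := by
    rintro _ ⟨X, hX, rfl⟩
    rw [hε, h.killing_E_gradingPiece hi hX, mul_zero]

/-- This gives uniqueness of `E^*`. Only degree `0` needs an argument: there `X + θ X` lies in `𝔪`,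
so `X` may be replaced by half of `X - θ X`, which lies in `𝔤_0 ∩ 𝔮`. -/
lemma isDualCovector_apply {ε : Dual ℝ (L ⧸ 𝔪)} (hε : IsDualCovector θ Φ 𝔭 𝔪 E ε) (X : L) :
    ε (𝔪.mkQ X) = (killingForm ℝ L E E)⁻¹ * killingForm ℝ L E X := by
  refine h.induction_gradingPiece (p := fun X => ε (𝔪.mkQ X) =
    (killingForm ℝ L E E)⁻¹ * killingForm ℝ L E X) (fun i X hX => ?_) (fun X Y hX hY => ?_) X
  · by_cases hi : i = 0
    · subst hi
      have hEE := (h.killing_E_pos hne).ne'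
      have hX0 : ⁅E, X⁆ = 0 := h.grading.central X hX
      have hpp := h.lie_E_eq_zero_iff.1 hX0
      have hθX : θ X ∈ gradingPiece Φ 𝔭 0 := by simpa using h.theta_mem_gradingPiece hX
      have hk : ε (𝔪.mkQ (X + θ X)) = 0 := by
        have h0 : 𝔪.mkQ (X + θ X) = 0 := (Submodule.Quotient.mk_eq_zero 𝔪).2
          ((hm _).2 ⟨h.cartan.theta_add_mem_kPart X, 𝔭.add_mem hpp.1 hpp.2⟩)
        rw [h0, map_zero]
      have hθ : killingForm ℝ L E (θ X) = -killingForm ℝ L E X := by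
        rw [h.cartan.killing_theta_right, h.theta_E, map_neg, LinearMap.neg_apply]
      -- The constant makes `(X - θ X) - c E` orthogonal to `E`; the factor `2` comes from `B(E, θ
      -- X) = -B(E, X)`.
      set c : ℝ := 2 * ((killingForm ℝ L E E)⁻¹ * killingForm ℝ L E X) with hc
      have hq := hε.apply_orthogonal ((X - θ X) - c • E)
        ⟨Submodule.sub_mem _ (Submodule.sub_mem _ hX hθX)
          (Submodule.smul_mem _ _ h.grading.mem_zero),
          Submodule.sub_mem _ (h.cartan.sub_theta_mem_qPart X)
            (Submodule.smul_mem _ _ h.E_mem_qPart)⟩ (by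
          rw [map_sub, map_sub, map_smul, hθ, smul_eq_mul, hc]
          field_simp
          ring)
      simp only [map_sub, map_smul, map_add, hε.apply_self, smul_eq_mul, mul_one] at hq hk
      linarith
    · rw [hε.apply_piece i hi _ ⟨X, hX, rfl⟩, h.killing_E_gradingPiece hi hX, mul_zero]
  · simp only [map_add] at hX hY ⊢
    rw [hX, hY, mul_add]

omit hm hne in
lemma hasBidegree_covector {ε : Dual ℝ (L ⧸ 𝔪)}
    (hε : ∀ X, ε (𝔪.mkQ X) = (killingForm ℝ L E E)⁻¹ * killingForm ℝ L E X) :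
    HasBidegree (quotOneZero 𝔪 𝔭) (quotZeroOne 𝔪 θ) 1 0
      (AlternatingMap.ofSubsingleton ℝ (L ⧸ 𝔪) ℝ (0 : Fin 1) ε) := by
  refine ⟨rfl, fun v s hs => ?_⟩
  rcases hs with ⟨hc, -⟩ | ⟨hc, hs⟩
  · exact absurd (s.card_le_univ) (by simpa using hc)
  · obtain ⟨j, hj⟩ := Finset.card_pos.1 hc
    obtain ⟨X, hX, hXv⟩ := hs j hj
    rw [Subsingleton.elim j 0] at hXv
    change ε (v 0) = 0
    rw [← hXv, hε, h.killing_E_kPart hX, mul_zero]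

section Form

variable {η : (L ⧸ 𝔪) [⋀^Fin 2]→ₗ[ℝ] ℝ} (hη : ∀ X Y, η ![𝔪.mkQ X, 𝔪.mkQ Y] =
  -((killingForm ℝ L E E)⁻¹ * killingForm ℝ L E ⁅X, Y⁆))

omit hm hne
include hη

/-- On `𝔭 × 𝔭` use `B([E, X], Y) = 0`; on `𝔨 × 𝔨` use that `𝔨` is a subalgebra orthogonal to `E`. -/
lemma hasBidegree_form : HasBidegree (quotOneZero 𝔪 𝔭) (quotZeroOne 𝔪 θ) 1 1 η := by
  refine hasBidegree_one_one ?_ ?_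
  · rintro _ ⟨X, hX, rfl⟩ _ ⟨Y, hY, rfl⟩
    rw [hη, ← killing_lie_left, h.killing_lie_E hX hY, mul_zero, neg_zero]
  · rintro _ ⟨X, hX, rfl⟩ _ ⟨Y, hY, rfl⟩
    have hXY : ⁅X, Y⁆ ∈ kPart θ := by
      rw [mem_kPart, LieEquiv.map_lie, mem_kPart.1 hX, mem_kPart.1 hY]
    rw [hη, h.killing_E_kPart hXY, mul_zero, neg_zero]

omit [FiniteDimensional ℝ L] in
lemma form_apply {i : ℤ} {X : L} (hX : X ∈ gradingPiece Φ 𝔭 i) (Y : L) :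
    η ![𝔪.mkQ X, 𝔪.mkQ Y] = -((i : ℝ) * (killingForm ℝ L E E)⁻¹ * killingForm ℝ L X Y) := by
  rw [hη, ← killing_lie_left, h.grading.lie_eq i X hX, map_smul, LinearMap.smul_apply, smul_eq_mul]
  ring

omit hη in
lemma killing_gradingPiece_self {i : ℤ} (hi : 0 < i) {X Y : L} (hX : X ∈ gradingPiece Φ 𝔭 i)
    (hY : Y ∈ gradingPiece Φ 𝔭 i) : killingForm ℝ L X Y = 0 := by
  have h1 := h.killing_lie_E (h.gradingPiece_le hi.le hX) (h.gradingPiece_le hi.le hY)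
  rw [h.grading.lie_eq i X hX, map_smul, LinearMap.smul_apply, smul_eq_mul, mul_eq_zero] at h1
  exact h1.resolve_left (by exact_mod_cast hi.ne')

/-- The summand `θ Y` of `G_Y` contributes nothing: it lies in `𝔤_i`, which is isotropic for `B`
when `i > 0`. -/
lemma form_vecF_vecG {i : ℤ} (hi : 0 < i) {X Y : L} (hX : X ∈ gradingPiece Φ 𝔭 i)
    (hY : Y ∈ gradingPiece Φ 𝔭 (-i)) : η ![vecF 𝔪 X, vecG 𝔪 θ Y] =
      -((i : ℝ) * (killingForm ℝ L E E)⁻¹ * killingForm ℝ L X Y) := by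
  have hθY : θ Y ∈ gradingPiece Φ 𝔭 i := by simpa using h.theta_mem_gradingPiece hY
  rw [vecF, vecG, h.form_apply hη hX, map_add, h.killing_gradingPiece_self hi hX hθY, add_zero]

include hne

/-- Testing a vector against its image under `θ`, which lies in the opposite degree, yields a
nonzero multiple of its squared norm. -/
lemma form_nondegenerate {i : ℤ} (hi : 0 < i) :
    (∀ u ∈ quotPiece 𝔪 Φ 𝔭 (-i), (∀ v ∈ quotPiece 𝔪 Φ 𝔭 i, η ![u, v] = 0) → u = 0) ∧
    (∀ v ∈ quotPiece 𝔪 Φ 𝔭 i, (∀ u ∈ quotPiece 𝔪 Φ 𝔭 (-i), η ![u, v] = 0) → v = 0) := by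
  have hc : (i : ℝ) * (killingForm ℝ L E E)⁻¹ ≠ 0 :=
    mul_ne_zero (by exact_mod_cast hi.ne') (inv_ne_zero (h.killing_E_pos hne).ne')
  have key : ∀ X ∈ gradingPiece Φ 𝔭 i, ∀ Y, η ![𝔪.mkQ Y, 𝔪.mkQ X] = 0 →
      killingForm ℝ L X Y = 0 := fun X hX Y h0 => by
    rw [alternating_swap, h.form_apply hη hX, neg_neg] at h0
    exact (mul_eq_zero.1 h0).resolve_left hc
  constructor
  · rintro _ ⟨Y, hY, rfl⟩ h0
    have hθY : θ Y ∈ gradingPiece Φ 𝔭 i := by simpa using h.theta_mem_gradingPiece hY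
    have h1 := key _ hθY Y (h0 _ ⟨_, hθY, rfl⟩)
    rw [killing_comm] at h1
    rw [h.cartan.eq_zero_of_killing h1, map_zero]
  · rintro _ ⟨X, hX, rfl⟩ h0
    have h1 := key X hX _ (h0 _ ⟨_, h.theta_mem_gradingPiece hX, rfl⟩)
    rw [h.cartan.eq_zero_of_killing h1, map_zero]

end Form

end IsGradedParabolic

end Quotient

/-! ### The adjoint action and Lie algebras of subgroups -/

section AdjointAction

variable {d : ℕ} {G : Type*} [TopologicalSpace G] [ChartedSpace (EuclideanSpace ℝ (Fin d)) G]
  [Group G] [LieGroup (𝓡 d) ∞ G]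

lemma contMDiff_conj (g : G) : ContMDiff (𝓡 d) (𝓡 d) ∞ (fun x : G => g * x * g⁻¹) :=
  (contMDiff_mul_right (a := g⁻¹)).comp (contMDiff_mul_left (a := g))

lemma mdifferentiable_conj (g : G) : MDifferentiable (𝓡 d) (𝓡 d) (fun x : G => g * x * g⁻¹) :=
  (contMDiff_conj g).mdifferentiable (by simp)

lemma mdifferentiable_mul_left (g : G) : MDifferentiable (𝓡 d) (𝓡 d) (fun x : G => g * x) :=
  (contMDiff_mul_left (I := 𝓡 d) (n := ∞) (a := g)).mdifferentiable (by simp)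

lemma mfderiv_conj_conj {a b : G} (hab : a * b = 1) {x y : G} (hy : b * x * b⁻¹ = y)
    (v : TangentSpace (𝓡 d) x) :
    mfderiv (𝓡 d) (𝓡 d) (fun z : G => a * z * a⁻¹) y
      (mfderiv (𝓡 d) (𝓡 d) (fun z : G => b * z * b⁻¹) x v) = v := by
  obtain rfl : a = b⁻¹ := eq_inv_of_mul_eq_one_left hab
  have h : (fun z : G => b⁻¹ * z * b⁻¹⁻¹) ∘ (fun z : G => b * z * b⁻¹) = id := by
    ext z
    simp [mul_assoc]
  have h' := mfderiv_comp_apply_of_eq (I := 𝓡 d) (I' := 𝓡 d) (I'' := 𝓡 d) _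
    (mdifferentiable_conj b⁻¹ y) (mdifferentiable_conj b x) hy v
  rw [h, mfderiv_id] at h'
  exact h'.symm

lemma Ad_Ad {a b : G} (hab : a * b = 1) (X : Lie d G) : Ad a (Ad b X) = X :=
  mfderiv_conj_conj hab (by simp) X

lemma mfderiv_conj_mulInvariantVectorField (g h : G) (X : Lie d G) :
    mfderiv (𝓡 d) (𝓡 d) (fun y : G => g * y * g⁻¹) h (mulInvariantVectorField X h) =
      mulInvariantVectorField (Ad g X : Lie d G) (g * h * g⁻¹) := by
  have heq : (fun y : G => g * y * g⁻¹) ∘ (fun y => h * y) =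
      (fun y => (g * h * g⁻¹) * y) ∘ (fun y : G => g * y * g⁻¹) := by
    ext y
    simp [mul_assoc]
  have h1 := mfderiv_comp_apply_of_eq (I := 𝓡 d) (I' := 𝓡 d) (I'' := 𝓡 d) _
    (mdifferentiable_conj g h) (mdifferentiable_mul_left h 1) (mul_one h) X
  have h2 := mfderiv_comp_apply_of_eq (I := 𝓡 d) (I' := 𝓡 d) (I'' := 𝓡 d) _
    (mdifferentiable_mul_left (g * h * g⁻¹) 1) (mdifferentiable_conj g 1)
    (show g * 1 * g⁻¹ = 1 by simp) X
  rw [heq, h2] at h1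
  exact h1.symm

lemma mpullback_conj_mulInvariantVectorField (g : G) (X : Lie d G) :
    VectorField.mpullback (𝓡 d) (𝓡 d) (fun y : G => g * y * g⁻¹)
      (mulInvariantVectorField (Ad g X : Lie d G)) = mulInvariantVectorField X := by
  ext1 h
  have hinv : (mfderiv (𝓡 d) (𝓡 d) (fun y : G => g * y * g⁻¹) h).inverse =
      mfderiv (𝓡 d) (𝓡 d) (fun y : G => g⁻¹ * y * g⁻¹⁻¹) (g * h * g⁻¹) := by
    refine ContinuousLinearMap.inverse_eq ?_ ?_
    · ext1 v
      exact mfderiv_conj_conj (mul_inv_cancel g) (by simp [mul_assoc]) v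
    · ext1 v
      exact mfderiv_conj_conj (inv_mul_cancel g) rfl v
  rw [VectorField.mpullback_apply, ← mfderiv_conj_mulInvariantVectorField, hinv]
  exact mfderiv_conj_conj (inv_mul_cancel g) rfl _

omit [LieGroup (𝓡 d) ∞ G] in
lemma mulInvariantVectorField_one (X : Lie d G) : mulInvariantVectorField X (1 : G) = X := by
  have h : (fun x : G => 1 * x) = id := by ext x; simp
  rw [mulInvariantVectorField, h, mfderiv_id]
  rfl

/-- Conjugation pulls the left invariant field of `Ad(g) X` back to that of `X`, and pullback by a
diffeomorphism respects brackets of vector fields. -/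
lemma Ad_lie (g : G) (X Y : Lie d G) : Ad g ⁅X, Y⁆ = ⁅(Ad g X : Lie d G), (Ad g Y : Lie d G)⁆ := by
  have h := VectorField.mpullback_mlieBracket (I := 𝓡 d) (I' := 𝓡 d) (n := ∞)
    (f := fun y : G => g * y * g⁻¹) (x₀ := (1 : G))
    (mdifferentiableAt_mulInvariantVectorField (Ad g X : Lie d G))
    (mdifferentiableAt_mulInvariantVectorField (Ad g Y : Lie d G))
    (contMDiff_conj g).contMDiffAt (by simp [minSmoothness_of_isRCLikeNormedField]; exact WithTop.coe_le_coe.2 le_top)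
  rw [mpullback_conj_mulInvariantVectorField, mpullback_conj_mulInvariantVectorField,
    ← mulInvariantVector_mlieBracket, ← GroupLieAlgebra.bracket_def,
    ← GroupLieAlgebra.bracket_def] at h
  rw [← Ad_Ad (mul_inv_cancel g) ⁅(Ad g X : Lie d G), (Ad g Y : Lie d G)⁆,
    mpullback_conj_mulInvariantVectorField, mulInvariantVectorField_one] at h
  rw [← h, Ad_Ad (mul_inv_cancel g)]

/-- The adjoint action as an automorphism of the Lie algebra. -/
def AdEquiv (g : G) : Lie d G ≃ₗ⁅ℝ⁆ Lie d G where
  toFun := Ad g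
  map_add' := map_add (Ad g)
  map_smul' := map_smul (Ad g)
  map_lie' := Ad_lie g _ _
  invFun := Ad g⁻¹
  left_inv := Ad_Ad (inv_mul_cancel g)
  right_inv := Ad_Ad (mul_inv_cancel g)

omit [TopologicalSpace G] [ChartedSpace (EuclideanSpace ℝ (Fin d)) G] [LieGroup (𝓡 d) ∞ G] in
lemma oneParameter_zero {γ : ℝ → G} (hγ : ∀ s t, γ (s + t) = γ s * γ t) : γ 0 = 1 := by
  simpa using hγ 0 0

/-- The Lie algebra of a subgroup is invariant under the adjoint action of the subgroup. -/
lemma Ad_mem_lieOfSubgroup {H : Subgroup G} {g : G} (hg : g ∈ H) {X : Lie d G}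
    (hX : X ∈ lieOfSubgroup d H) : (Ad g X : Lie d G) ∈ lieOfSubgroup d H := by
  obtain ⟨γ, hγ, hadd, hmem, rfl⟩ := hX
  refine ⟨fun t => g * γ t * g⁻¹, (contMDiff_conj g).comp hγ, fun s t => ?_,
    fun t => H.mul_mem (H.mul_mem hg (hmem t)) (H.inv_mem hg), ?_⟩
  · simp only [hadd]
    group
  · have h := mfderiv_comp_apply_of_eq (I := 𝓘(ℝ, ℝ)) (I' := 𝓡 d) (I'' := 𝓡 d) _
      (mdifferentiable_conj g 1) (hγ.mdifferentiable (by simp) 0) (oneParameter_zero hadd) (1 : ℝ)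
    exact h.symm

/-- A smooth one-parameter subgroup is an integral curve of the left invariant vector field of its
initial velocity. -/
lemma isMIntegralCurve_oneParameter {γ : ℝ → G} (hγ : ContMDiff 𝓘(ℝ, ℝ) (𝓡 d) ∞ γ)
    (hadd : ∀ s t, γ (s + t) = γ s * γ t) :
    IsMIntegralCurve (I := 𝓡 d) γ
      (mulInvariantVectorField (mfderiv 𝓘(ℝ, ℝ) (𝓡 d) γ 0 (1 : ℝ) : Lie d G)) := by
  intro t
  have hd := hγ.mdifferentiable (by simp)
  have heq : γ ∘ (fun s => t + s) = (fun x => γ t * x) ∘ γ := by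
    ext s
    exact hadd t s
  have hdt : HasMFDerivAt 𝓘(ℝ, ℝ) 𝓘(ℝ, ℝ) (fun s : ℝ => t + s) 0 (ContinuousLinearMap.id ℝ ℝ) :=
    ((hasFDerivAt_id (0 : ℝ)).const_add t).hasMFDerivAt
  have h1 := mfderiv_comp_apply_of_eq (I := 𝓘(ℝ, ℝ)) (I' := 𝓘(ℝ, ℝ)) (I'' := 𝓡 d) _
    (hd t) hdt.mdifferentiableAt (add_zero t) (1 : ℝ)
  have h2 := mfderiv_comp_apply_of_eq (I := 𝓘(ℝ, ℝ)) (I' := 𝓡 d) (I'' := 𝓡 d) _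
    (mdifferentiable_mul_left (γ t) 1) (hd 0) (oneParameter_zero hadd) (1 : ℝ)
  rw [heq, h2, hdt.mfderiv] at h1
  have h3 := (hd t).hasMFDerivAt
  have h4 : mfderiv 𝓘(ℝ, ℝ) (𝓡 d) γ t = ContinuousLinearMap.smulRight (1 : ℝ →L[ℝ] ℝ)
      (mulInvariantVectorField (mfderiv 𝓘(ℝ, ℝ) (𝓡 d) γ 0 (1 : ℝ) : Lie d G) (γ t)) := by
    refine ContinuousLinearMap.ext_ring ?_
    refine Eq.trans h1.symm ?_
    refine Eq.trans ?_ (one_smul ℝ _).symm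
    rfl
  rw [h4] at h3
  exact h3

/-- One-parameter subgroups with the same initial velocity are integral curves of the same left
invariant field, hence equal on a Hausdorff group; so one curve lies in both subgroups. This yields
`𝔪 = 𝔨 ∩ 𝔭`. -/
lemma lieOfSubgroup_inf [T2Space G] (H K : Subgroup G) :
    lieOfSubgroup d (H ⊓ K) = lieOfSubgroup d H ∩ lieOfSubgroup d K := by
  ext X
  constructor
  · rintro ⟨γ, hγ, hadd, hmem, rfl⟩
    exact ⟨⟨γ, hγ, hadd, fun t => (hmem t).1, rfl⟩, ⟨γ, hγ, hadd, fun t => (hmem t).2, rfl⟩⟩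
  · rintro ⟨⟨γ, hγ, hadd, hmem, rfl⟩, ⟨γ', hγ', hadd', hmem', h⟩⟩
    have h1 := isMIntegralCurve_oneParameter hγ hadd
    have h2 := isMIntegralCurve_oneParameter hγ' hadd'
    rw [← h] at h2
    obtain rfl : γ = γ' := by
      refine isMIntegralCurve_Ioo_eq_of_contMDiff_boundaryless (t₀ := 0) ?_ h1 h2 ?_
      · exact (contMDiff_mulInvariantVectorField _).of_le
          (one_le_two.trans le_minSmoothness)
      · rw [oneParameter_zero hadd, oneParameter_zero hadd']
    exact ⟨γ, hγ, hadd, fun t => ⟨hmem t, hmem' t⟩, rfl⟩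

end AdjointAction

/-! ### The Maurer–Cartan equation in a chart -/

section MaurerCartan

/-- A map into continuous linear maps on a finite dimensional space is differentiable if it is so
pointwise. -/
lemma differentiableAt_of_clm_apply {E E' F : Type*} [NormedAddCommGroup E] [NormedSpace ℝ E]
    [NormedAddCommGroup E'] [NormedSpace ℝ E'] [FiniteDimensional ℝ E'] [NormedAddCommGroup F]
    [NormedSpace ℝ F] {A : E → E' →L[ℝ] F} {x : E}
    (h : ∀ v, DifferentiableAt ℝ (fun y => A y v) x) : DifferentiableAt ℝ A x := by
  let b := Module.finBasis ℝ E'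
  have hA : A = fun y => ∑ i, ContinuousLinearMap.smulRightL ℝ E' F
      (LinearMap.toContinuousLinearMap (b.coord i)) (A y (b i)) := by
    ext y v
    conv_lhs => rw [← b.sum_repr v, map_sum]
    simp [map_smul]
  rw [hA]
  exact DifferentiableAt.fun_sum fun i _ =>
    (ContinuousLinearMap.differentiableAt _).comp x (h (b i))

/-- The exterior derivative of a `1`-form on two vector fields on which it is constant. -/
lemma extDeriv_oneForm_of_const {E : Type*} [NormedAddCommGroup E] [NormedSpace ℝ E]
    {w : E → E [⋀^Fin 1]→L[ℝ] ℝ} {V : Fin 2 → E → E} {x : E} {c : Fin 2 → ℝ}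
    (hw : DifferentiableAt ℝ w x) (hV : ∀ i, DifferentiableAt ℝ (V i) x)
    (hc : ∀ i, ∀ᶠ y in nhds x, w y (fun _ => V i y) = c i) :
    extDeriv w x (fun i => V i x) =
      -w x (fun _ => VectorField.lieBracket ℝ (V 0) (V 1) x) := by
  rw [extDeriv_apply_vectorField hw hV]
  -- The derivative terms of the invariant formula vanish because the form is locally constant on
  -- the fields; only the bracket term remains.
  have hz : ∀ i : Fin 2, fderiv ℝ (fun y => w y (i.removeNth (fun j => V j y))) x = 0 := by
    intro i
    have hconst : (fun y => w y (i.removeNth (fun j => V j y))) =ᶠ[nhds x]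
        fun _ => c (i.succAbove 0) := by
      filter_upwards [hc (i.succAbove 0)] with y hy
      rw [← hy]
      congr 1
      ext1 j
      rw [Subsingleton.elim j 0]
      rfl
    rw [hconst.fderiv_eq, fderiv_const_apply]
  simp only [hz]
  have hv : ∀ j, Matrix.vecCons (VectorField.lieBracket ℝ (V 0) (V 1) x) j =
      fun _ : Fin 1 => VectorField.lieBracket ℝ (V 0) (V 1) x := fun j => by
    ext1 k
    rw [Subsingleton.elim k 0]
    rfl
  simp [hv]

lemma two_le_infty : (2 : ℕ∞ω) ≤ ∞ :=
  WithTop.coe_le_coe.2 le_top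

variable {d : ℕ} {G : Type*} [TopologicalSpace G] [ChartedSpace (EuclideanSpace ℝ (Fin d)) G]
  [Group G] [LieGroup (𝓡 d) ∞ G]

lemma toLie_mulInvariantVectorField (g : G) (X : Lie d G) :
    toLie g (mulInvariantVectorField X g) = X := by
  have h : (fun x : G => g⁻¹ * x) ∘ (fun x : G => g * x) = id := by
    ext z
    simp
  have h' := mfderiv_comp_apply_of_eq (I := 𝓡 d) (I' := 𝓡 d) (I'' := 𝓡 d) _
    (mdifferentiable_mul_left g⁻¹ g) (mdifferentiable_mul_left g 1) (mul_one g) X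
  rw [h, mfderiv_id] at h'
  exact h'.symm

lemma mulInvariantVectorField_toLie (g : G) (v : TangentSpace (𝓡 d) g) :
    mulInvariantVectorField (toLie g v) g = v := by
  have h : (fun x : G => g * x) ∘ (fun x : G => g⁻¹ * x) = id := by
    ext z
    simp
  have h' := mfderiv_comp_apply_of_eq (I := 𝓡 d) (I' := 𝓡 d) (I'' := 𝓡 d) _
    (mdifferentiable_mul_left g 1) (mdifferentiable_mul_left g⁻¹ g) (inv_mul_cancel g) v
  rw [h, mfderiv_id] at h'
  exact h'.symm

/-- The left invariant vector field of `X`, read in the chart at `g`. -/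
def chartField (g : G) (X : Lie d G) : EuclideanSpace ℝ (Fin d) → EuclideanSpace ℝ (Fin d) :=
  fun y => (mfderiv (𝓡 d) (𝓡 d) (extChartAt (𝓡 d) g).symm y).inverse
    (mulInvariantVectorField X ((extChartAt (𝓡 d) g).symm y))

/-- The left trivialization of the tangent bundle, read in the chart at `g`. -/
def chartToLie (g : G) (y : EuclideanSpace ℝ (Fin d)) :
    EuclideanSpace ℝ (Fin d) →L[ℝ] EuclideanSpace ℝ (Fin d) :=
  (toLie ((extChartAt (𝓡 d) g).symm y)).comp (mfderiv (𝓡 d) (𝓡 d) (extChartAt (𝓡 d) g).symm y)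

omit [LieGroup (𝓡 d) ∞ G] in
lemma chartField_eq (g : G) (X : Lie d G) :
    chartField g X = VectorField.mpullbackWithin 𝓘(ℝ, EuclideanSpace ℝ (Fin d)) (𝓡 d)
      (extChartAt (𝓡 d) g).symm (mulInvariantVectorField X) (Set.range (𝓡 d)) := by
  ext1 y
  simp only [modelWithCornersSelf_coe, Set.range_id, VectorField.mpullbackWithin_univ]
  rfl

lemma differentiableAt_chartField (g : G) (X : Lie d G) :
    DifferentiableAt ℝ (chartField g X) (extChartAt (𝓡 d) g g) := by
  have h2 : IsManifold (𝓡 d) 2 G := IsManifold.of_le (n := ∞) two_le_infty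
  have h := MDifferentiableWithinAt.differentiableWithinAt_mpullbackWithin_vectorField
    (mdifferentiableAt_mulInvariantVectorField X (g := g)).mdifferentiableWithinAt (s := Set.univ)
  rw [← chartField_eq] at h
  simpa [← differentiableWithinAt_univ] using h

lemma chart_isInvertible (g : G) {y : EuclideanSpace ℝ (Fin d)}
    (hy : y ∈ (extChartAt (𝓡 d) g).target) :
    (mfderiv (𝓡 d) (𝓡 d) (extChartAt (𝓡 d) g).symm y).IsInvertible := by
  have h1 : IsManifold (𝓡 d) 1 G := IsManifold.of_le (n := ∞) (one_le_two.trans two_le_infty)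
  have := isInvertible_mfderivWithin_extChartAt_symm hy
  simpa using this

lemma chartToLie_chartField (g : G) {y : EuclideanSpace ℝ (Fin d)}
    (hy : y ∈ (extChartAt (𝓡 d) g).target) (X : Lie d G) :
    chartToLie g y (chartField g X y) = X :=
  (congrArg (toLie _) ((chart_isInvertible g hy).self_apply_inverse _)).trans
    (toLie_mulInvariantVectorField _ X)

lemma chartField_self (g : G) (X : Lie d G) :
    chartField g X (extChartAt (𝓡 d) g g) = mulInvariantVectorField X g := by
  have h1 : IsManifold (𝓡 d) 1 G := IsManifold.of_le (n := ∞) (one_le_two.trans two_le_infty)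
  have hp : ∀ p : G, p = g → (mulInvariantVectorField X p : EuclideanSpace ℝ (Fin d)) =
      mulInvariantVectorField X g := by
    rintro p rfl
    rfl
  have h := mfderivWithin_extChartAt_symm_inverse_apply (I := 𝓡 d) (x := g)
    (mulInvariantVectorField X g)
  simp only [modelWithCornersSelf_coe, Set.range_id, mfderivWithin_univ] at h
  refine Eq.trans ?_ h
  exact congrArg
    (mfderiv (𝓡 d) (𝓡 d) (extChartAt (𝓡 d) g).symm (extChartAt (𝓡 d) g g)).inverse
    (hp ((extChartAt (𝓡 d) g).symm (extChartAt (𝓡 d) g g)) (extChartAt_to_inv g))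

lemma chartField_lieBracket (g : G) (X Y : Lie d G) :
    VectorField.lieBracket ℝ (chartField g X) (chartField g Y) (extChartAt (𝓡 d) g g) =
      chartField g ⁅X, Y⁆ (extChartAt (𝓡 d) g g) := by
  have h1 : IsManifold (𝓡 d) 1 G := IsManifold.of_le (n := ∞) (one_le_two.trans two_le_infty)
  have h := congrFun (mulInvariantVector_mlieBracket X Y) g
  rw [← GroupLieAlgebra.bracket_def, ← VectorField.mlieBracketWithin_univ,
    VectorField.mlieBracketWithin_apply, ← chartField_eq, ← chartField_eq,
    mfderiv_extChartAt_self] at h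
  rw [chartField_self, h]
  simp only [modelWithCornersSelf_coe, Set.range_id, Set.preimage_univ, Set.inter_univ,
    VectorField.lieBracketWithin_univ]
  have hid : (ContinuousLinearMap.id ℝ (EuclideanSpace ℝ (Fin d))).inverse =
    ContinuousLinearMap.id ℝ (EuclideanSpace ℝ (Fin d)) := ContinuousLinearMap.inverse_id
  exact (congrArg (fun f => f (VectorField.lieBracket ℝ (chartField g X) (chartField g Y)
    (extChartAt (𝓡 d) g g))) hid).symm

/-- The map is pointwise inverse to `X ↦ chartField g X y`, which is differentiable in `y` for each
fixed `X`; inversion of operators is differentiable. -/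
lemma differentiableAt_chartToLie (g : G) :
    DifferentiableAt ℝ (chartToLie g) (extChartAt (𝓡 d) g g) := by
  let E := EuclideanSpace ℝ (Fin d)
  let A : E → E →L[ℝ] E := fun y =>
    (mfderiv (𝓡 d) (𝓡 d) (extChartAt (𝓡 d) g).symm y).inverse.comp
      (mfderiv (𝓡 d) (𝓡 d) (fun x => (extChartAt (𝓡 d) g).symm y * x) (1 : G))
  have hA : DifferentiableAt ℝ A (extChartAt (𝓡 d) g g) :=
    differentiableAt_of_clm_apply fun v => differentiableAt_chartField g v
  have hBA : ∀ y ∈ (extChartAt (𝓡 d) g).target, chartToLie g y * A y = 1 := fun y hy =>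
    ContinuousLinearMap.ext fun v => chartToLie_chartField g hy v
  have hAB : ∀ y ∈ (extChartAt (𝓡 d) g).target, A y * chartToLie g y = 1 := fun y hy => by
    refine ContinuousLinearMap.ext fun v => ?_
    have h1 := mulInvariantVectorField_toLie ((extChartAt (𝓡 d) g).symm y)
      (mfderiv (𝓡 d) (𝓡 d) (extChartAt (𝓡 d) g).symm y v)
    exact (congrArg
      (mfderiv (𝓡 d) (𝓡 d) (extChartAt (𝓡 d) g).symm y).inverse h1).trans
      ((chart_isInvertible g hy).inverse_apply_self v)
  have hinv : chartToLie g =ᶠ[nhds (extChartAt (𝓡 d) g g)] fun y => Ring.inverse (A y) := by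
    filter_upwards [extChartAt_target_mem_nhds (I := 𝓡 d) g] with y hy
    exact (Ring.inverse_unit ⟨A y, chartToLie g y, hAB y hy, hBA y hy⟩).symm
  have hmem := mem_extChartAt_target (I := 𝓡 d) g
  have hunit : IsUnit (A (extChartAt (𝓡 d) g g)) :=
    ⟨⟨_, chartToLie g _, hAB _ hmem, hBA _ hmem⟩, rfl⟩
  exact ((differentiableAt_inverse (𝕜 := ℝ) hunit).comp _ hA).congr_of_eventuallyEq hinv

/-- The Maurer–Cartan equation: on left invariant `1`-forms, the exterior derivative is minus the
dual of the Lie bracket. -/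
theorem extDerivAt_invariantOneForm (𝔪 : Submodule ℝ (Lie d G)) (ε : Dual ℝ (Lie d G ⧸ 𝔪)) (g : G)
    (v : Fin 2 → TangentSpace (𝓡 d) g) :
    extDerivAt (invariantOneForm 𝔪 ε) g v = -ε (𝔪.mkQ ⁅toLie g (v 0), toLie g (v 1)⁆) := by
  let E := EuclideanSpace ℝ (Fin d)
  have h1 : IsManifold (𝓡 d) 1 G := IsManifold.of_le (n := ∞) (one_le_two.trans two_le_infty)
  let l : E →L[ℝ] ℝ := LinearMap.toContinuousLinearMap (ε ∘ₗ 𝔪.mkQ : Lie d G →ₗ[ℝ] ℝ)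
  let w : E → E [⋀^Fin 1]→L[ℝ] ℝ := fun y =>
    ContinuousAlternatingMap.ofSubsingleton ℝ E ℝ (0 : Fin 1) (l.comp (chartToLie g y))
  have hw : extDerivAt (invariantOneForm 𝔪 ε) g v = extDeriv w (extChartAt (𝓡 d) g g) v := by
    -- The tangent space at `g` is modelled through the chart at `g`, so that chart has identity
    -- derivative there.
    have hid : ∀ i, mfderiv (𝓡 d) (modelWithCornersSelf ℝ E) (extChartAt (𝓡 d) g) g (v i) = v i :=
      fun i => by
        rw [mfderiv_extChartAt_self]
        rfl
    exact congrArg (extDeriv w (extChartAt (𝓡 d) g g)) (funext hid)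
  have hdw : DifferentiableAt ℝ w (extChartAt (𝓡 d) g g) := by
    exact (ContinuousAlternatingMap.ofSubsingletonLIE (𝕜 := ℝ) (E := E) (F := ℝ)
      (0 : Fin 1)).toContinuousLinearEquiv.differentiableAt.comp _
      ((differentiableAt_const l).clm_comp (differentiableAt_chartToLie g))
  have hv : (v : Fin 2 → E) = fun i => chartField g (toLie g (v i)) (extChartAt (𝓡 d) g g) := by
    ext1 i
    rw [chartField_self, mulInvariantVectorField_toLie]
  have hmc := extDeriv_oneForm_of_const (w := w) (V := fun i => chartField g (toLie g (v i)))
    (c := fun i => l (toLie g (v i))) hdw (fun i => differentiableAt_chartField g _) fun i => by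
      filter_upwards [extChartAt_target_mem_nhds (I := 𝓡 d) g] with y hy
      exact congrArg l (chartToLie_chartField g hy _)
  refine hw.trans ((congrArg (extDeriv w (extChartAt (𝓡 d) g g)) hv).trans (hmc.trans ?_))
  rw [chartField_lieBracket]
  exact congrArg Neg.neg (congrArg l
    (chartToLie_chartField g (mem_extChartAt_target (I := 𝓡 d) g) _))

end MaurerCartan

/-! ### Invariant exterior derivatives in terms of the Lie bracket -/

section Final

variable {d : ℕ} {G : Type*} [TopologicalSpace G] [ChartedSpace (EuclideanSpace ℝ (Fin d)) G]
  [Group G] [LieGroup (𝓡 d) ∞ G]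

lemma isInvariantExtDeriv_of_apply {𝔪 : Submodule ℝ (Lie d G)} {ε : Dual ℝ (Lie d G ⧸ 𝔪)}
    {η : (Lie d G ⧸ 𝔪) [⋀^Fin 2]→ₗ[ℝ] ℝ}
    (h : ∀ X Y : Lie d G, η ![𝔪.mkQ X, 𝔪.mkQ Y] = -ε (𝔪.mkQ ⁅X, Y⁆)) :
    IsInvariantExtDeriv 𝔪 ε η := fun g v => by
  rw [extDerivAt_invariantOneForm, ← h, eq_vec_two fun j => 𝔪.mkQ (toLie g (v j))]

lemma IsInvariantExtDeriv.apply {𝔪 : Submodule ℝ (Lie d G)} {ε : Dual ℝ (Lie d G ⧸ 𝔪)}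
    {η : (Lie d G ⧸ 𝔪) [⋀^Fin 2]→ₗ[ℝ] ℝ} (h : IsInvariantExtDeriv 𝔪 ε η) (X Y : Lie d G) :
    η ![𝔪.mkQ X, 𝔪.mkQ Y] = -ε (𝔪.mkQ ⁅X, Y⁆) := by
  have h1 : ∀ X : Lie d G, toLie (1 : G) X = X := fun X => by
    conv_lhs => rw [← mulInvariantVectorField_one X]
    exact toLie_mulInvariantVectorField 1 X
  have h2 := h 1 ![X, Y]
  rw [extDerivAt_invariantOneForm, eq_vec_two fun j => 𝔪.mkQ _] at h2
  simp only [Matrix.cons_val_zero, Matrix.cons_val_one, h1] at h2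
  exact h2.symm

end Final

end PoissonTransform

end

open PoissonTransform in
theorem mainTheorem4 {d : ℕ} {G : Type*} [TopologicalSpace G] [T2Space G] [ConnectedSpace G]
    [ChartedSpace (EuclideanSpace ℝ (Fin d)) G] [Group G] [LieGroup (𝓡 d) ∞ G]
    [LieAlgebra.IsSemisimple ℝ (Lie d G)] [Finite (Subgroup.center G)]
    (θ : Lie d G ≃ₗ⁅ℝ⁆ Lie d G) (hθ : IsCartanInvolution θ)
    (𝔞 : Submodule ℝ (Lie d G)) (h𝔞 : IsMaximalAbelian θ 𝔞)
    (Φ : Set (Dual ℝ 𝔞)) (hΦ : IsPositiveSystem 𝔞 Φ)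
    (𝔭 : LieSubalgebra ℝ (Lie d G)) (h𝔭 : pZero θ 𝔞 Φ ≤ 𝔭.toSubmodule) (h𝔭_ne : 𝔭 ≠ ⊤)
    (K P : Subgroup G) (𝔪 : Submodule ℝ (Lie d G)) (hKP : IsGroupData θ 𝔭 K P 𝔪)
    (E : Lie d G) (hE : IsGradingElement Φ 𝔭 E) :
    ∃ ε : Dual ℝ (Lie d G ⧸ 𝔪),
      -- `ε = E^*` is the covector dual to `E`, and it is the only one
      IsDualCovector θ Φ 𝔭 𝔪 E ε ∧
      (∀ ε' : Dual ℝ (Lie d G ⧸ 𝔪), IsDualCovector θ Φ 𝔭 𝔪 E ε' → ε' = ε) ∧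
      -- it is nontrivial, `M`-invariant and of degree `(1,0)`
      ε ≠ 0 ∧
      (∀ m ∈ K ⊓ P, ∀ X : Lie d G, ε (𝔪.mkQ (Ad m X)) = ε (𝔪.mkQ X)) ∧
      HasBidegree (quotOneZero 𝔪 𝔭) (quotZeroOne 𝔪 θ) 1 0
        (AlternatingMap.ofSubsingleton ℝ (Lie d G ⧸ 𝔪) ℝ (0 : Fin 1) ε) ∧
      -- its `K`-derivative `dK` and `P`-derivative `dP` exist and are unique
      ∃ dK dP : (Lie d G ⧸ 𝔪) [⋀^Fin 2]→ₗ[ℝ] ℝ,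
        IsPartialDerivs 𝔪 (quotOneZero 𝔪 𝔭) (quotZeroOne 𝔪 θ) ε dK dP ∧
        (∀ dK' dP' : (Lie d G ⧸ 𝔪) [⋀^Fin 2]→ₗ[ℝ] ℝ,
          IsPartialDerivs 𝔪 (quotOneZero 𝔪 𝔭) (quotZeroOne 𝔪 θ) ε dK' dP' →
            dK' = dK ∧ dP' = dP) ∧
        dK = 0 ∧
        killingForm ℝ (Lie d G) E E ≠ 0 ∧
        (∀ i : ℤ, 0 < i → ∀ X ∈ gradingPiece Φ 𝔭 i, ∀ Y ∈ gradingPiece Φ 𝔭 (-i),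
          dP ![vecF 𝔪 X, vecG 𝔪 θ Y] =
            -((i : ℝ) * (killingForm ℝ (Lie d G) E E)⁻¹ * killingForm ℝ (Lie d G) X Y)) ∧
        -- `dP` is `M`-invariant and so are the subspaces `(𝔤/𝔪)_i`; the restriction of `dP` to
        -- `(𝔤/𝔪)_{-i} × (𝔤/𝔪)_i` is nondegenerate
        (∀ m ∈ K ⊓ P, ∀ X Y : Lie d G,
          dP ![𝔪.mkQ (Ad m X), 𝔪.mkQ (Ad m Y)] = dP ![𝔪.mkQ X, 𝔪.mkQ Y]) ∧
        (∀ m ∈ K ⊓ P, ∀ i : ℤ, ∀ X : Lie d G, 𝔪.mkQ X ∈ quotPiece 𝔪 Φ 𝔭 i →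
          𝔪.mkQ (Ad m X) ∈ quotPiece 𝔪 Φ 𝔭 i) ∧
        (∀ i : ℤ, 0 < i →
          (∀ u ∈ quotPiece 𝔪 Φ 𝔭 (-i),
            (∀ v ∈ quotPiece 𝔪 Φ 𝔭 i, dP ![u, v] = 0) → u = 0) ∧
          (∀ v ∈ quotPiece 𝔪 Φ 𝔭 i,
            (∀ u ∈ quotPiece 𝔪 Φ 𝔭 (-i), dP ![u, v] = 0) → v = 0)) := by
  have h : IsGradedParabolic θ 𝔞 Φ 𝔭 E := ⟨hθ, h𝔞, hΦ, h𝔭, hE⟩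
  have hm : ∀ X, X ∈ 𝔪 ↔ X ∈ kPart θ ∧ X ∈ 𝔭 := fun X => by
    have h1 := hKP.lie_M
    rw [lieOfSubgroup_inf, hKP.lie_K, hKP.lie_P] at h1
    exact (Set.ext_iff.1 h1 X).symm
  have hAdK : ∀ m ∈ K ⊓ P, ∀ X ∈ kPart θ, AdEquiv m X ∈ kPart θ := fun m hm X hX => by
    have h1 := Ad_mem_lieOfSubgroup (d := d) hm.1 (X := X) (by rw [hKP.lie_K]; exact hX)
    rwa [hKP.lie_K] at h1
  have hAdP : ∀ m ∈ K ⊓ P, ∀ X ∈ 𝔭, AdEquiv m X ∈ 𝔭 := fun m hm X hX => by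
    have h1 := Ad_mem_lieOfSubgroup (d := d) hm.2 (X := X) (by rw [hKP.lie_P]; exact hX)
    rwa [hKP.lie_P] at h1
  have hAdE : ∀ m ∈ K ⊓ P, AdEquiv m E = E := fun m hm =>
    h.automorphism_E (hAdK m hm) (hAdK m⁻¹ (inv_mem hm)) (hAdP m hm) (hAdP m⁻¹ (inv_mem hm))
  have hAdB : ∀ m ∈ K ⊓ P, ∀ X : Lie d G,
      killingForm ℝ (Lie d G) E (Ad m X) = killingForm ℝ (Lie d G) E X := fun m hm X => by
    have h1 := LieAlgebra.killingForm_of_equiv_apply (AdEquiv m) E X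
    rwa [hAdE m hm] at h1
  obtain ⟨ε, hε⟩ := h.exists_covector hm
  obtain ⟨η, hη⟩ := h.exists_form hm
  have hηε : ∀ X Y : Lie d G, η ![𝔪.mkQ X, 𝔪.mkQ Y] = -ε (𝔪.mkQ ⁅X, Y⁆) := fun X Y => by
    rw [hη, hε]
  have hεE := h.isDualCovector h𝔭_ne hε
  refine ⟨ε, hεE, fun ε' hε' => ?_, ?_, fun m hm X => ?_, h.hasBidegree_covector hε, 0, η,
    ⟨?_, hasBidegree_zero _ _ rfl, h.hasBidegree_form hη⟩, fun dK' dP' hd => ?_, rfl,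
    (h.killing_E_pos h𝔭_ne).ne', fun i hi X hX Y hY => h.form_vecF_vecG hη hi hX hY,
    fun m hm X Y => ?_, fun m hmM i X hX => ?_, fun i hi => h.form_nondegenerate h𝔭_ne hη hi⟩
  · refine LinearMap.ext fun x => ?_
    obtain ⟨X, rfl⟩ := 𝔪.mkQ_surjective x
    rw [hε, h.isDualCovector_apply hm h𝔭_ne hε']
  · rintro rfl
    exact zero_ne_one hεE.apply_self
  · rw [hε, hε, hAdB m hm]
  · rw [zero_add]
    exact isInvariantExtDeriv_of_apply hηε
  · have hsum : dK' + dP' = η := by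
      refine AlternatingMap.ext fun v => ?_
      obtain ⟨X, hX⟩ := 𝔪.mkQ_surjective (v 0)
      obtain ⟨Y, hY⟩ := 𝔪.mkQ_surjective (v 1)
      rw [eq_vec_two v, ← hX, ← hY, hd.extDeriv_eq.apply, hηε]
    -- On `𝔭 × 𝔭` both `dP'` and the total derivative `η` vanish for reasons of degree, hence so
    -- does `dK'`; being of degree `(2, 0)`, it is determined there since `𝔤 = 𝔭 + 𝔨`.
    have hdK : dK' = 0 := by
      refine hd.degree_K.eq_zero h.quot_sup_eq_top fun a ha b hb => ?_
      have hmem : ∀ j ∈ (Finset.univ : Finset (Fin 2)), ![a, b] j ∈ quotOneZero 𝔪 𝔭 := by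
        simpa [Fin.forall_fin_two] using ⟨ha, hb⟩
      have h1 := hd.degree_P.2 ![a, b] Finset.univ (Or.inl ⟨by simp, hmem⟩)
      have h2 := (h.hasBidegree_form hη).2 ![a, b] Finset.univ (Or.inl ⟨by simp, hmem⟩)
      rw [← hsum, AlternatingMap.add_apply, h1, add_zero] at h2
      exact h2
    exact ⟨hdK, by rw [← hsum, hdK, zero_add]⟩
  · rw [hη, hη, ← Ad_lie, hAdB m hm]
  -- `X` need only agree modulo `𝔪` with some `Z` in `𝔤_i`. `Ad m` preserves the eigenspaces of `ad
  -- E` because it fixes `E`, and it preserves `𝔪 = 𝔨 ∩ 𝔭`.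
  · obtain ⟨Z, hZ, hZX⟩ := hX
    refine ⟨Ad m Z, ?_, ?_⟩
    · have h1 := h.mem_gradingPiece_iff.1 hZ
      have h2 := congrArg (AdEquiv m) h1
      rw [LieEquiv.map_lie, hAdE m hmM, map_smul] at h2
      exact h.mem_gradingPiece_iff.2 h2
    · have h3 : Z - X ∈ 𝔪 := (Submodule.Quotient.eq 𝔪).1 hZX
      obtain ⟨h4, h5⟩ := (hm _).1 h3
      have h6 := (hm _).2 ⟨hAdK m hmM _ h4, hAdP m hmM _ h5⟩
      rw [map_sub] at h6
      exact (Submodule.Quotient.eq 𝔪).2 h6
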